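/- Let $n,d\ge 0$ be integers. For a partition $R\vdash m$ let $V_R$ be the irreducible complex representation of $S_m$ labelled by $R$, $d(R)=\dim V_R$, and $\chi^R$ its character. Let $$\mathcal K(n,d)=\{x\in\mathbb C(S_n)^{\otimes d}:\ \gamma_1^{\otimes d}\,x\,\gamma_2^{\otimes d}=x\ \text{ for all }\gamma_1,\gamma_2\in S_n\},$$ on which $S_d$ acts by permuting the tensor factors, and for $Y\vdash d$ let $\mathcal K(n,d)_Y$ be its $V_Y$-isotypic subspace. The number $N(n,d)$ of colour-symmetrised tensor invariants of rank $d$ (and degree $n$) is the number of classes of $d$-tuples in $S_n^{\times d}$ under the equivalence $(\sigma_1,\dots,\sigma_d)\sim(\gamma_1\sigma_{\alpha(1)}\gamma_2,\dots,\gamma_1\sigma_{\alpha(d)}\gamma_2)$ with $\gamma_1,\gamma_2\in S_n$, $\alpha\in S_d$. For $p\vdash d$ let $p_i$ be the number of parts of $p$ equal to $i$, let $\mathrm{Sym}(p)=\prod_i i^{p_i}p_i!$, and let $\sigma_p\in S_d$ be any permutation of cycle type $p$. Then: (1) $$N(n,d)=\frac1{d!\,(n!)^2}\sum_{\alpha\in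 S_d}\ \sum_{R_1,\dots,R_d}\ \sum_{\sigma_1,\sigma_2\in S_n}\ \prod_a\chi^{R^{(a)}}(\sigma_1^{l_a})\,\chi^{R^{(a)}}(\sigma_2^{l_a}),$$ where $a$ runs over the cycles of $\alpha$ (fixed points included), $l_a$ is the length of $a$, the $R_k\vdash n$ are restricted to families that are constant on each cycle of $\alpha$, and $R^{(a)}$ is the common value on the cycle $a$. (2) Equivalently, $$N(n,d)=\frac1{(n!)^2}\sum_{p\vdash d}\frac1{\mathrm{Sym}(p)}\sum_{R_{i,j}}\ \sum_{\sigma_1,\sigma_2\in S_n}\ \prod_{i=1}^d\prod_{j=1}^{p_i}\chi^{R_{i,j}}(\sigma_1^i)\,\chi^{R_{i,j}}(\sigma_2^i),$$ where the $R_{i,j}$ ($1\le i\le d$, $1\le j\le p_i$) run independently over the partitions of $n$. (3) $N(n,d)$ is the dimension of the $S_d$-invariant subspace of $\mathcal K(n,d)$, and that subspace is $\mathcal K(n,d)_{[d]}$, where $[d]$ is the one-row partition. (4) For every $Y\vdash d$, $$\dim\mathcal K(n,d)_Y=\frac{d(Y)}{(n!)^2}\sum_{p\vdash d}\chi^Y(\sigma_p)\,\frac1{\mathrm{Sym}(p)}\sum_{R_{i,j}}\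 \sum_{\sigma_1,\sigma_2\in S_n}\ \prod_{i=1}^d\prod_{j=1}^{p_i}\chi^{R_{i,j}}(\sigma_1^i)\,\chi^{R_{i,j}}(\sigma_2^i).$$ -/

import Mathlib

open Equiv (Perm)

namespace TensorInvariants

noncomputable section

/-! ### Irreducible representations of symmetric groups, labelled by partitions -/

/-- The complex group algebra `ℂ(S_n)`. -/
abbrev GroupAlg (n : ℕ) : Type := MonoidAlgebra ℂ (Perm (Fin n))

/-- The rows of the Young diagram of a partition, in weakly decreasing order. -/
def rowLengths {n : ℕ} (R : n.Partition) : Composition n where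
  blocks := R.parts.sort (· ≥ ·)
  blocks_pos := fun hi => R.parts_pos (by simpa using hi)
  blocks_sum := by rw [← Multiset.sum_coe, Multiset.sort_eq, R.parts_sum]

/-- The row containing the entry `k` when the Young diagram of `R` is filled with
`0, 1, ..., n - 1` row by row, from left to right. -/
def rowOf {n : ℕ} (R : n.Partition) (k : Fin n) : ℕ := (rowLengths R).index k

/-- The column containing the entry `k` in the same filling. -/
def colOf {n : ℕ} (R : n.Partition) (k : Fin n) : ℕ := (rowLengths R).invEmbedding k

/-- The Young symmetrizer of `R`: the sum of the row-preserving permutations times the signed sum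
of the column-preserving permutations. -/
def youngSymmetrizer {n : ℕ} (R : n.Partition) : GroupAlg n :=
  (∑ g : Perm (Fin n) with ∀ k, rowOf R (g k) = rowOf R k, MonoidAlgebra.of ℂ _ g) *
    ∑ g : Perm (Fin n) with ∀ k, colOf R (g k) = colOf R k,
      ((Perm.sign g : ℤ) : ℂ) • MonoidAlgebra.of ℂ _ g

/-- The irreducible `S_n`-module `V_R`, as the left ideal generated by the Young symmetrizer. -/
abbrev IrrepSpace {n : ℕ} (R : n.Partition) : Type :=
  ↥(Ideal.span {youngSymmetrizer R} : Ideal (GroupAlg n))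

/-- The representation of `S_n` on `V_R`, by left multiplication. -/
def irrep {n : ℕ} (R : n.Partition) : Representation ℂ (Perm (Fin n)) (IrrepSpace R) :=
  Representation.ofModule' (IrrepSpace R)

/-- The character `χ^R` of `S_n`. -/
def chi {n : ℕ} (R : n.Partition) (g : Perm (Fin n)) : ℂ := (irrep R).character g

/-- The dimension `d(R)` of `V_R`. -/
def irrepDim {n : ℕ} (R : n.Partition) : ℕ := Module.finrank ℂ (IrrepSpace R)

/-- `Sym(p) = ∏_i i^{p_i} p_i!`, with `p_i` the number of parts of `p` equal to `i`. -/
def symFactor {d : ℕ} (p : d.Partition) : ℕ :=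
  ∏ i ∈ Finset.Icc 1 d, i ^ p.parts.count i * (p.parts.count i).factorial

/-! ### The space `𝒦(n,d)` and the colour exchange action of `S_d` -/

/-- `ℂ(S_n)^{⊗ d}`, as the group algebra of `S_n^{× d}`: the tuple `(σ_1, ..., σ_d)` is the basis
element `σ_1 ⊗ ⋯ ⊗ σ_d`. -/
abbrev TensorAlg (n d : ℕ) : Type := MonoidAlgebra ℂ (Fin d → Perm (Fin n))

/-- `γ ⊗ γ ⊗ ⋯ ⊗ γ`. -/
def diagElem (n d : ℕ) (γ : Perm (Fin n)) : TensorAlg n d :=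
  MonoidAlgebra.of ℂ (Fin d → Perm (Fin n)) fun _ => γ

/-- A permutation of the colours acts on tuples by permuting the entries: the entry of colour `a`
becomes the entry of colour `α a`. -/
def permTuple (n d : ℕ) (α : Perm (Fin d)) :
    (Fin d → Perm (Fin n)) →* (Fin d → Perm (Fin n)) where
  toFun s := fun a => s (α⁻¹ a)
  map_one' := rfl
  map_mul' _ _ := rfl

/-- `S_d` permutes the tensor factors. -/
def colourRep (n d : ℕ) : Representation ℂ (Perm (Fin d)) (TensorAlg n d) where
  toFun α := (MonoidAlgebra.mapDomainAlgHom ℂ ℂ (permTuple n d α)).toLinearMap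
  map_one' := by
    ext s : 2
    simp [permTuple]
  map_mul' α β := by
    ext s : 2
    simp [permTuple]

theorem colourRep_of (n d : ℕ) (α : Perm (Fin d)) (s : Fin d → Perm (Fin n)) :
    colourRep n d α (MonoidAlgebra.of ℂ _ s) = MonoidAlgebra.of ℂ _ fun a => s (α⁻¹ a) := by
  simp [colourRep, permTuple]

theorem colourRep_mul (n d : ℕ) (α : Perm (Fin d)) (x y : TensorAlg n d) :
    colourRep n d α (x * y) = colourRep n d α x * colourRep n d α y :=
  map_mul (MonoidAlgebra.mapDomainAlgHom ℂ ℂ (permTuple n d α)) x y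

theorem colourRep_diagElem (n d : ℕ) (α : Perm (Fin d)) (γ : Perm (Fin n)) :
    colourRep n d α (diagElem n d γ) = diagElem n d γ :=
  colourRep_of n d α _

/-- `𝒦(n,d)`: the elements of `ℂ(S_n)^{⊗ d}` invariant under the left and the right diagonal
action of `S_n`. It is stable under the action of `S_d`. -/
def KSub (n d : ℕ) : Subrepresentation (colourRep n d) where
  toSubmodule :=
    { carrier := {x | ∀ γ₁ γ₂ : Perm (Fin n), diagElem n d γ₁ * x * diagElem n d γ₂ = x}
      add_mem' := fun {x y} hx hy γ₁ γ₂ => by rw [mul_add, add_mul, hx, hy]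
      zero_mem' := fun γ₁ γ₂ => by simp
      smul_mem' := fun c x hx γ₁ γ₂ => by rw [mul_smul_comm, smul_mul_assoc, hx] }
  apply_mem_toSubmodule := fun α x hx γ₁ γ₂ => by
    have h := congrArg (colourRep n d α) (hx γ₁ γ₂)
    simpa only [colourRep_mul, colourRep_diagElem] using h

/-- The vector space `𝒦(n,d)`. -/
abbrev K (n d : ℕ) : Type := ↥(KSub n d).toSubmodule

/-- The representation of `S_d` on `𝒦(n,d)`. -/
def KRep (n d : ℕ) : Representation ℂ (Perm (Fin d)) (K n d) := (KSub n d).toRepresentation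

/-- The `σ`-isotypic subspace of a representation `ρ`: the sum of the images of all intertwining
maps from `σ` to `ρ`. -/
def isotypic {G V W : Type} [Group G] [AddCommGroup V] [Module ℂ V] [AddCommGroup W] [Module ℂ W]
    (σ : Representation ℂ G V) (ρ : Representation ℂ G W) : Submodule ℂ W :=
  ⨆ f : Representation.IntertwiningMap σ ρ, LinearMap.range f.toLinearMap

/-- `𝒦(n,d)_Y`: the subspace of `𝒦(n,d)` transforming in the irreducible representation `Y` of
`S_d`. -/
def KIsotypic (n d : ℕ) (Y : d.Partition) : Submodule ℂ (K n d) := isotypic (irrep Y) (KRep n d)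

/-! ### Colour-symmetrised tensor invariants -/

/-- Two `d`-tuples of permutations define the same colour-symmetrised tensor invariant if they are
related by left and right diagonal multiplication and a permutation of the `d` colours. -/
def colourSetoid (n d : ℕ) : Setoid (Fin d → Perm (Fin n)) where
  r s t := ∃ (α : Perm (Fin d)) (γ₁ γ₂ : Perm (Fin n)), ∀ a, t a = γ₁ * s (α a) * γ₂
  iseqv :=
    { refl := fun s => ⟨1, 1, 1, fun a => by simp⟩
      symm := by
        rintro s t ⟨α, γ₁, γ₂, h⟩
        exact ⟨α⁻¹, γ₁⁻¹, γ₂⁻¹, fun a => by simp [h, mul_assoc]⟩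
      trans := by
        rintro s t u ⟨α, γ₁, γ₂, h⟩ ⟨β, δ₁, δ₂, h'⟩
        exact ⟨α * β, δ₁ * γ₁, γ₂ * δ₂, fun a => by simp [h, h', mul_assoc]⟩ }

/-- The number of colour-symmetrised tensor invariants of rank `d` and degree `n`. -/
def numColourSymm (n d : ℕ) : ℕ := Nat.card (Quotient (colourSetoid n d))

/-! ### The character sums -/

/-- The cycles of `α`, with the fixed points as cycles of length one. -/
abbrev Cycles {d : ℕ} (α : Perm (Fin d)) : Type := Quotient (Perm.SameCycle.setoid α)

instance {d : ℕ} (α : Perm (Fin d)) : Fintype (Cycles α) := Fintype.ofFinite _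

/-- The length of a cycle. -/
def cycleLength {d : ℕ} {α : Perm (Fin d)} (a : Cycles α) : ℕ :=
  Nat.card {i : Fin d // (Quotient.mk _ i : Cycles α) = a}

/-- The contribution of `α ∈ S_d`: the sum over all `R_1, ..., R_d` that are constant on each
cycle `a` of `α`, with common value `R^{(a)}`, and over all `σ₁, σ₂ ∈ S_n`, of
`∏_a χ^{R^{(a)}}(σ₁^{l_a}) χ^{R^{(a)}}(σ₂^{l_a})`. -/
def permCharSum (n : ℕ) {d : ℕ} (α : Perm (Fin d)) : ℂ :=
  ∑ R : Fin d → n.Partition, ∑ σ₁ : Perm (Fin n), ∑ σ₂ : Perm (Fin n),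
    if ∀ i j, α.SameCycle i j → R i = R j then
      ∏ a : Cycles α, chi (R a.out) (σ₁ ^ cycleLength a) * chi (R a.out) (σ₂ ^ cycleLength a)
    else 0

/-- The contribution of a partition `p` of `d` with `p_i` parts equal to `i`: the sum over all
families `R_{i,j} ⊢ n` with `1 ≤ i ≤ d` and `1 ≤ j ≤ p_i`, and over all `σ₁, σ₂ ∈ S_n`, of
`∏_{i,j} χ^{R_{i,j}}(σ₁^i) χ^{R_{i,j}}(σ₂^i)`. The index `i : Fin d` stands for `i + 1`. -/
def partitionCharSum (n : ℕ) {d : ℕ} (p : d.Partition) : ℂ :=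
  ∑ R : (i : Fin d) → Fin (p.parts.count (i.val + 1)) → n.Partition,
    ∑ σ₁ : Perm (Fin n), ∑ σ₂ : Perm (Fin n),
      ∏ i : Fin d, ∏ j : Fin (p.parts.count (i.val + 1)),
        chi (R i j) (σ₁ ^ (i.val + 1)) * chi (R i j) (σ₂ ^ (i.val + 1))

end

end TensorInvariants

/-! Triples `(α, γ₁, γ₂)` act on `d`-tuples with `numColourSymm` orbits, so Burnside's lemma reduces
the counting formulas to fixed tuples. A fixed tuple amounts to one entry `x` for each cycle of `α`,
subject only to `γ₁ ^ l * x * γ₂ ^ l = x` with `l` the length of the cycle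
(`card_twisted_invariant`). Such `x` are the elements conjugating `γ₂ ^ l` to the inverse of `γ₁ ^
l`, and column orthogonality counts them by a sum over `R` of products of two characters. Expanding
the product over cycles gives `permCharSum`, or `partitionCharSum` once the cycles are sorted by
length; a cycle type `p` occurs `d! / Sym(p)` times.

Column orthogonality (`sum_partition_chi_mul_chi`) rests on the left ideals of the Young
symmetrizers being irreducible and pairwise inequivalent, which follows from row and column
combinatorics. That they exhaust the irreducibles need not be shown separately: conjugacy classes
are also indexed by partitions, so the character table is square, and the one-sided inverse given by
row orthogonality is two-sided.

Averaging over both diagonal actions projects onto `𝒦(n,d)`, so the trace of `α` there is an average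
of the same fixed-point counts (`KRep_character`). The invariants have dimension the mean of this
character, the isotypic parts have dimension the trace of the character projection
(`isProj_isotypicProj`), and the one-row partition gives the trivial representation. -/

namespace TensorInvariants

/-! ### Combinatorics of rows and columns of Young diagrams -/

/-- A filling of a left-justified array: `r k` and `c k` are the row and the column of `k`. -/
structure LeftJustified {ι : Type*} (r c : ι → ℕ) : Prop where
  inj : ∀ k k', r k = r k' → c k = c k' → k = k'
  fill : ∀ k, ∀ j < c k, ∃ k', r k' = r k ∧ c k' = j

/-- If row `i` reaches column `j`, then `c` takes all `j` values below `j` there, and `c'`, being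
injective on the row, cannot do better. Otherwise every entry of the row is counted on the right. -/
theorem LeftJustified.card_row_lt_le {ι : Type*} [Fintype ι] {r c c' : ι → ℕ}
    (h : LeftJustified r c) (h' : ∀ k k', r k = r k' → c' k = c' k' → k = k') (i j : ℕ) :
    (Finset.univ.filter fun k => r k = i ∧ c' k < j).card ≤
      (Finset.univ.filter fun k => r k = i ∧ c k < j).card := by
  classical
  by_cases hj : ∃ k, r k = i ∧ j ≤ c k
  · obtain ⟨k, hk, hjk⟩ := hj
    have h1 : (Finset.univ.filter fun k => r k = i ∧ c' k < j).card ≤ (Finset.range j).card := by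
      apply Finset.card_le_card_of_injOn c'
      · intro x hx
        simp at hx ⊢
        exact hx.2
      · intro x hx y hy hxy
        simp at hx hy
        exact h' x y (hx.1.trans hy.1.symm) hxy
    refine h1.trans ?_
    apply Finset.card_le_card_of_surjOn c
    intro x hx
    simp at hx
    obtain ⟨k', h1, h2⟩ := h.fill k x (by omega)
    exact ⟨k', by simp [h1, h2, hk, hx], h2⟩
  · push Not at hj
    apply Finset.card_le_card
    intro k hk
    simp at hk ⊢
    exact ⟨hk.1, hj k hk.1⟩

theorem card_lt_eq_sum_rows {ι : Type*} [Fintype ι] (r c : ι → ℕ) (j : ℕ) :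
    (Finset.univ.filter fun k => c k < j).card =
      ∑ i ∈ Finset.univ.image r, (Finset.univ.filter fun k => r k = i ∧ c k < j).card := by
  classical
  rw [Finset.card_eq_sum_card_fiberwise (f := r) (t := Finset.univ.image r)
    (fun k _ => by simp)]
  refine Finset.sum_congr rfl fun i _ => ?_
  congr 1
  ext k
  simp [and_comm]

theorem LeftJustified.card_lt_le {ι : Type*} [Fintype ι] {r c c' : ι → ℕ}
    (h : LeftJustified r c) (h' : ∀ k k', r k = r k' → c' k = c' k' → k = k') (j : ℕ) :
    (Finset.univ.filter fun k => c' k < j).card ≤ (Finset.univ.filter fun k => c k < j).card := by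
  rw [card_lt_eq_sum_rows r c', card_lt_eq_sum_rows r c]
  exact Finset.sum_le_sum fun i _ => h.card_row_lt_le h' i j

/-- Equal totals force equality in every row, because the inequality holds row by row. Hence on each
row `c'` takes every value that `c` takes, and matching these values defines `p`. -/
theorem LeftJustified.exists_perm {ι : Type*} [Fintype ι] {r c c' : ι → ℕ}
    (h : LeftJustified r c) (h' : ∀ k k', r k = r k' → c' k = c' k' → k = k')
    (hc : ∀ j, (Finset.univ.filter fun k => c' k < j).card =
      (Finset.univ.filter fun k => c k < j).card) :
    ∃ p : Perm ι, (∀ k, r (p k) = r k) ∧ ∀ k, c' (p k) = c k := by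
  classical
  have hle := h.card_row_lt_le h'
  have heq : ∀ i ∈ Finset.univ.image r, ∀ j, (Finset.univ.filter fun k => r k = i ∧ c' k < j).card =
      (Finset.univ.filter fun k => r k = i ∧ c k < j).card := by
    intro i hi j
    have := hc j
    rw [card_lt_eq_sum_rows r c', card_lt_eq_sum_rows r c] at this
    exact (Finset.sum_eq_sum_iff_of_le fun i _ => hle i j).1 this i hi
  have split : ∀ (f : ι → ℕ) (i j : ℕ), (Finset.univ.filter fun k => r k = i ∧ f k < j + 1).card =
      (Finset.univ.filter fun k => r k = i ∧ f k < j).card +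
      (Finset.univ.filter fun k => r k = i ∧ f k = j).card := by
    intro f i j
    rw [← Finset.card_union_of_disjoint]
    · congr 1
      ext k
      simp
      grind
    · rw [Finset.disjoint_left]
      intro k
      simp
      grind
  have hex : ∀ k, ∃ k', r k' = r k ∧ c' k' = c k := by
    intro k
    have hk : r k ∈ Finset.univ.image r := by simp
    have h1 := split c (r k) (c k)
    have h2 := split c' (r k) (c k)
    rw [heq _ hk, heq _ hk] at h2
    have h3 : 0 < (Finset.univ.filter fun k' => r k' = r k ∧ c k' = c k).card :=
      Finset.card_pos.2 ⟨k, by simp⟩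
    have h4 : 0 < (Finset.univ.filter fun k' => r k' = r k ∧ c' k' = c k).card := by omega
    obtain ⟨k', hk'⟩ := Finset.card_pos.1 h4
    exact ⟨k', by simpa using hk'⟩
  choose p hp1 hp2 using hex
  have hinj : Function.Injective p := fun k k' hkk => h.inj k k'
    (by rw [← hp1 k, ← hp1 k', hkk]) (by rw [← hp2 k, ← hp2 k', hkk])
  exact ⟨Equiv.ofBijective p (Finite.injective_iff_bijective.1 hinj), hp1, hp2⟩

theorem index_eq_of_rowOf_eq {n : ℕ} {R : n.Partition} {k k' : Fin n} (h : rowOf R k = rowOf R k') :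
    (rowLengths R).index k = (rowLengths R).index k' := Fin.ext h

theorem leftJustified_rowOf_colOf {n : ℕ} (R : n.Partition) :
    LeftJustified (rowOf R) (colOf R) where
  inj k k' h1 h2 := by
    have h := index_eq_of_rowOf_eq h1
    unfold colOf at h2
    rw [Composition.coe_invEmbedding, Composition.coe_invEmbedding, h] at h2
    have h3 := (rowLengths R).sizeUpTo_index_le k
    have h4 := (rowLengths R).sizeUpTo_index_le k'
    rw [h] at h3
    exact Fin.ext (by omega)
  fill k j hj := by
    have hj' : j < (rowLengths R).blocksFun ((rowLengths R).index k) :=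
      hj.trans ((rowLengths R).invEmbedding k).isLt
    refine ⟨(rowLengths R).embedding _ ⟨j, hj'⟩, ?_, ?_⟩
    · simp [rowOf, Composition.index_embedding]
    · simp [colOf]

theorem card_colOf_eq {n : ℕ} (R : n.Partition) (j : ℕ) :
    (Finset.univ.filter fun k => colOf R k = j).card = R.parts.countP (j < ·) := by
  classical
  have h1 : (Finset.univ.filter fun k => colOf R k = j).card =
      ∑ i : Fin (rowLengths R).length, if j < (rowLengths R).blocksFun i then 1 else 0 := by
    rw [Finset.card_filter, ← Equiv.sum_comp (rowLengths R).blocksFinEquiv, Fintype.sum_sigma]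
    refine Finset.sum_congr rfl fun i _ => ?_
    have : ∀ x : Fin ((rowLengths R).blocksFun i),
        colOf R ((rowLengths R).blocksFinEquiv ⟨i, x⟩) = x := fun x =>
      (rowLengths R).invEmbedding_comp i x
    simp only [this]
    split_ifs with h
    · rw [Finset.sum_eq_single ⟨j, h⟩]
      · simp
      · intro b _ hb
        rw [if_neg]
        intro hbj
        exact hb (Fin.ext hbj)
      · simp
    · refine Finset.sum_eq_zero fun x _ => if_neg ?_
      have := x.isLt
      omega
  have h2 : R.parts = Multiset.map (rowLengths R).blocksFun Finset.univ.val := by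
    have : R.parts = ((rowLengths R).blocks : Multiset ℕ) := (Multiset.sort_eq _ _).symm
    rw [this, ← Composition.ofFn_blocksFun, Fin.univ_val_map]
  rw [h1, h2, Multiset.countP_map, ← Finset.card_filter]
  rfl

/-- The counts determine the column lengths, that is, the conjugate partition; the multiplicity of
the part `j + 1` is the difference of the lengths of columns `j` and `j + 1`. -/
theorem partition_ext_of_card_colOf_lt {n : ℕ} {R S : n.Partition}
    (h : ∀ j, (Finset.univ.filter fun k => colOf R k < j).card =
      (Finset.univ.filter fun k => colOf S k < j).card) : R = S := by
  classical
  have split : ∀ (f : Fin n → ℕ) (j : ℕ), (Finset.univ.filter fun k => f k < j + 1).card =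
      (Finset.univ.filter fun k => f k < j).card + (Finset.univ.filter fun k => f k = j).card := by
    intro f j
    rw [← Finset.card_union_of_disjoint]
    · congr 1
      ext k
      simp
      grind
    · rw [Finset.disjoint_left]
      intro k
      simp
      grind
  have hP : ∀ j, R.parts.countP (j < ·) = S.parts.countP (j < ·) := by
    intro j
    rw [← card_colOf_eq, ← card_colOf_eq]
    have h1 := split (colOf R) j
    have h2 := split (colOf S) j
    rw [h, h] at h1
    omega
  have hc : ∀ (m : Multiset ℕ) (j : ℕ),
      m.countP (j < ·) = m.countP (j + 1 < ·) + m.count (j + 1) := by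
    intro m j
    induction m using Multiset.induction_on with
    | empty => simp
    | cons a m ih =>
      rw [Multiset.countP_cons, Multiset.countP_cons, Multiset.count_cons, ih]
      split_ifs <;> omega
  ext j
  rcases j with _ | j
  · rw [Multiset.count_eq_zero_of_notMem, Multiset.count_eq_zero_of_notMem]
    · exact fun h0 => (S.parts_pos h0).ne' rfl
    · exact fun h0 => (R.parts_pos h0).ne' rfl
  · have h1 := hc R.parts j
    have h2 := hc S.parts j
    rw [hP, hP] at h1
    omega

/-! ### Young symmetrizers -/

/-- The sum of the row-preserving permutations. -/
noncomputable def rowSum {n : ℕ} (R : n.Partition) : GroupAlg n :=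
  ∑ g : Perm (Fin n) with ∀ k, rowOf R (g k) = rowOf R k, MonoidAlgebra.of ℂ _ g

/-- The signed sum of the column-preserving permutations. -/
noncomputable def colSum {n : ℕ} (R : n.Partition) : GroupAlg n :=
  ∑ g : Perm (Fin n) with ∀ k, colOf R (g k) = colOf R k,
    ((Perm.sign g : ℤ) : ℂ) • MonoidAlgebra.of ℂ _ g

theorem youngSymmetrizer_eq {n : ℕ} (R : n.Partition) :
    youngSymmetrizer R = rowSum R * colSum R := rfl

theorem preserves_inv {ι : Type*} {f : ι → ℕ} {p : Perm ι} (hp : ∀ k, f (p k) = f k) (k : ι) :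
    f (p⁻¹ k) = f k := by
  have := hp (p⁻¹ k)
  simpa using this.symm

theorem rowSum_mul_of {n : ℕ} (R : n.Partition) {p : Perm (Fin n)}
    (hp : ∀ k, rowOf R (p k) = rowOf R k) : rowSum R * MonoidAlgebra.of ℂ _ p = rowSum R := by
  rw [rowSum, Finset.sum_mul]
  refine Finset.sum_bij' (fun g _ => g * p) (fun g _ => g * p⁻¹) ?_ ?_ ?_ ?_ ?_
  · intro g hg
    simp at hg ⊢
    simp [hg, hp]
  · intro g hg
    simp only [Finset.mem_filter, Finset.mem_univ, true_and, Perm.mul_apply] at hg ⊢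
    intro k
    rw [hg, preserves_inv hp]
  · simp
  · simp
  · intro g _
    rw [map_mul]

theorem of_mul_colSum {n : ℕ} (R : n.Partition) {q : Perm (Fin n)}
    (hq : ∀ k, colOf R (q k) = colOf R k) :
    MonoidAlgebra.of ℂ _ q * colSum R = ((Perm.sign q : ℤ) : ℂ) • colSum R := by
  rw [colSum, Finset.mul_sum, Finset.smul_sum]
  refine Finset.sum_bij' (fun g _ => q * g) (fun g _ => q⁻¹ * g) ?_ ?_ ?_ ?_ ?_
  · intro g hg
    simp at hg ⊢
    simp [hg, hq]
  · intro g hg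
    simp only [Finset.mem_filter, Finset.mem_univ, true_and, Perm.mul_apply] at hg ⊢
    intro k
    rw [preserves_inv hq, hg]
  · simp
  · simp
  · intro g _
    rw [map_mul, mul_smul_comm, smul_smul, ← Int.cast_mul, ← Units.val_mul, ← map_mul]
    congr 3
    rw [← mul_assoc, Int.units_mul_self, one_mul]

/-- The transposition of `k` and `k'` is absorbed by the row sum; moved across `g` it becomes a
transposition inside a column of `S`, which the column sum turns into a sign. The product equals its
own negative. -/
theorem rowSum_mul_of_mul_colSum_eq_zero {n : ℕ} (R S : n.Partition) {g : Perm (Fin n)}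
    {k k' : Fin n} (hne : k ≠ k') (hr : rowOf R k = rowOf R k')
    (hc : colOf S (g⁻¹ k) = colOf S (g⁻¹ k')) :
    rowSum R * MonoidAlgebra.of ℂ _ g * colSum S = 0 := by
  have h1 : rowSum R * MonoidAlgebra.of ℂ _ (Equiv.swap k k') = rowSum R := by
    refine rowSum_mul_of R fun x => ?_
    rcases eq_or_ne x k with rfl | h
    · simp [hr]
    rcases eq_or_ne x k' with rfl | h'
    · simp [hr]
    · rw [Equiv.swap_apply_of_ne_of_ne h h']
  have h2 : MonoidAlgebra.of ℂ _ (Equiv.swap (g⁻¹ k) (g⁻¹ k')) * colSum S = - colSum S := by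
    rw [of_mul_colSum S fun x => ?_]
    · rw [Perm.sign_swap (fun h => hne (g⁻¹.injective h))]
      simp
    rcases eq_or_ne x (g⁻¹ k) with rfl | h
    · rw [Equiv.swap_apply_left, hc]
    rcases eq_or_ne x (g⁻¹ k') with rfl | h'
    · rw [Equiv.swap_apply_right, hc]
    · rw [Equiv.swap_apply_of_ne_of_ne h h']
  have h3 := Equiv.swap_mul_eq_mul_swap g k k'
  have h4 : rowSum R * MonoidAlgebra.of ℂ _ g * colSum S =
      - (rowSum R * MonoidAlgebra.of ℂ _ g * colSum S) := by
    conv_lhs => rw [← h1, mul_assoc (rowSum R), ← map_mul, h3, map_mul, ← mul_assoc, mul_assoc, h2]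
    rw [mul_neg]
  have h5 : (2 : ℂ) • (rowSum R * MonoidAlgebra.of ℂ _ g * colSum S) = 0 := by
    rw [two_smul, ← eq_neg_iff_add_eq_zero]
    exact h4
  exact (smul_eq_zero.1 h5).resolve_left two_ne_zero

theorem card_lt_comp {ι : Type*} [Fintype ι] (c : ι → ℕ) (g : Perm ι) (j : ℕ) :
    (Finset.univ.filter fun k => c (g k) < j).card = (Finset.univ.filter fun k => c k < j).card := by
  simp only [Finset.card_filter]
  exact Equiv.sum_comp g fun k => if c k < j then 1 else 0

/-- Either two entries share a row of `R` and a column of the filling moved by `g`, and the product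
vanishes, or `g` factors as a row-preserving times a column-preserving permutation. -/
theorem rowSum_mul_of_mul_colSum_mem {n : ℕ} (R : n.Partition) (g : Perm (Fin n)) :
    ∃ z : ℂ, rowSum R * MonoidAlgebra.of ℂ _ g * colSum R = z • youngSymmetrizer R := by
  by_cases h : ∀ k k', rowOf R k = rowOf R k' → colOf R (g⁻¹ k) = colOf R (g⁻¹ k') → k = k'
  · obtain ⟨p, hp1, hp2⟩ := (leftJustified_rowOf_colOf R).exists_perm
      (c' := fun k => colOf R (g⁻¹ k)) h (card_lt_comp (colOf R) g⁻¹)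
    have hq : ∀ k, colOf R ((p⁻¹ * g) k) = colOf R k := by
      intro k
      rw [← hp2 ((p⁻¹ * g) k)]
      simp
    refine ⟨((Perm.sign (p⁻¹ * g) : ℤ) : ℂ), ?_⟩
    have : g = p * (p⁻¹ * g) := by simp
    conv_lhs => rw [this, map_mul, ← mul_assoc, rowSum_mul_of R hp1, mul_assoc, of_mul_colSum R hq]
    rw [mul_smul_comm, youngSymmetrizer_eq]
  · push Not at h
    obtain ⟨k, k', hr, hc, hne⟩ := h
    exact ⟨0, by rw [rowSum_mul_of_mul_colSum_eq_zero R R hne hr hc, zero_smul]⟩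

theorem rowSum_mul_mul_colSum_mem {n : ℕ} (R : n.Partition) (x : GroupAlg n) :
    ∃ z : ℂ, rowSum R * x * colSum R = z • youngSymmetrizer R := by
  induction x using MonoidAlgebra.induction_on with
  | of g => exact rowSum_mul_of_mul_colSum_mem R g
  | add x y hx hy =>
    obtain ⟨z, hz⟩ := hx
    obtain ⟨w, hw⟩ := hy
    exact ⟨z + w, by rw [mul_add, add_mul, hz, hw, add_smul]⟩
  | smul r x hx =>
    obtain ⟨z, hz⟩ := hx
    exact ⟨r * z, by rw [mul_smul_comm, smul_mul_assoc, hz, smul_smul]⟩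

theorem youngSymmetrizer_mul_mul {n : ℕ} (R : n.Partition) (x : GroupAlg n) :
    ∃ z : ℂ, youngSymmetrizer R * x * youngSymmetrizer R = z • youngSymmetrizer R := by
  obtain ⟨z, hz⟩ := rowSum_mul_mul_colSum_mem R (colSum R * x * rowSum R)
  refine ⟨z, ?_⟩
  rw [← hz, youngSymmetrizer_eq]
  simp only [mul_assoc]

theorem card_colOf_lt_le_of_ne_zero {n : ℕ} {R S : n.Partition} {x : GroupAlg n}
    (h : rowSum R * x * colSum S ≠ 0) (j : ℕ) :
    (Finset.univ.filter fun k => colOf S k < j).card ≤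
      (Finset.univ.filter fun k => colOf R k < j).card := by
  by_contra hj
  apply h
  -- The hypothesis `h` depends on `x` and is generalised, so the induction hypotheses read "nonzero
  -- implies zero"; this is why a nonzero summand is refuted at once.
  induction x using MonoidAlgebra.induction_on with
  | of g =>
    by_contra hg
    apply hj
    rw [← card_lt_comp (colOf S) g⁻¹]
    refine (leftJustified_rowOf_colOf R).card_lt_le (c' := fun k => colOf S (g⁻¹ k)) ?_ j
    intro k k' hr hc
    by_contra hne
    exact hg (rowSum_mul_of_mul_colSum_eq_zero R S hne hr hc)
  | add x y hx hy =>
    rw [mul_add, add_mul]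
    by_cases h1 : rowSum R * x * colSum S = 0
    · by_cases h2 : rowSum R * y * colSum S = 0
      · rw [h1, h2, add_zero]
      · exact (h2 (hy h2)).elim
    · exact (h1 (hx h1)).elim
  | smul r x hx =>
    rw [mul_smul_comm, smul_mul_assoc]
    by_cases h1 : rowSum R * x * colSum S = 0
    · rw [h1, smul_zero]
    · exact (h1 (hx h1)).elim

/-- A permutation preserving both rows and columns is the identity, so `1` arises from one product
only, the one with both factors trivial. -/
theorem youngSymmetrizer_coeff_one {n : ℕ} (R : n.Partition) :
    (youngSymmetrizer R).coeff 1 = 1 := by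
  classical
  rw [youngSymmetrizer, Finset.sum_mul_sum]
  simp only [MonoidAlgebra.of_apply, mul_smul_comm, MonoidAlgebra.single_mul_single, mul_one,
    MonoidAlgebra.coeff_sum, MonoidAlgebra.coeff_smul, MonoidAlgebra.coeff_single,
    Finsupp.finsetSum_apply, Finsupp.smul_apply, Finsupp.single_apply]
  rw [Finset.sum_eq_single 1, Finset.sum_eq_single 1]
  · simp
  · intro q _ hq
    rw [one_mul, if_neg hq, smul_zero]
  · simp
  · intro p hp hp1
    refine Finset.sum_eq_zero fun q hq => ?_
    rw [if_neg, smul_zero]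
    intro hpq
    apply hp1
    rw [mul_eq_one_iff_eq_inv] at hpq
    subst hpq
    simp only [Finset.mem_filter, Finset.mem_univ, true_and] at hp hq
    ext k
    exact congrArg _ ((leftJustified_rowOf_colOf R).inj _ _ (hp k) (preserves_inv hq k))
  · simp

theorem youngSymmetrizer_ne_zero {n : ℕ} (R : n.Partition) : youngSymmetrizer R ≠ 0 := by
  intro h
  have h1 := youngSymmetrizer_coeff_one R
  rw [h] at h1
  simp at h1

/-! ### Irreducibility and inequivalence of the modules `V_R` -/

/-- By semisimplicity the left ideal has an idempotent generator `e`, and `e = e * e = 0`. -/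
theorem ideal_eq_bot_of_mul_eq_zero {A : Type*} [Ring A] [IsSemisimpleRing A] (N : Ideal A)
    (h : ∀ x ∈ N, ∀ y ∈ N, x * y = 0) : N = ⊥ := by
  obtain ⟨e, he, rfl⟩ := IsSemisimpleRing.ideal_eq_span_idempotent N
  have hm : e ∈ Ideal.span {e} := Ideal.mem_span_singleton_self e
  have := h e hm e hm
  rw [he] at this
  simp [this]

theorem exists_youngSymmetrizer_mul_mul_ne_zero {n : ℕ} (R : n.Partition) :
    ∃ x : GroupAlg n, youngSymmetrizer R * x * youngSymmetrizer R ≠ 0 := by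
  by_contra! h
  apply youngSymmetrizer_ne_zero R
  rw [← Ideal.span_singleton_eq_bot]
  apply ideal_eq_bot_of_mul_eq_zero
  intro x hx y hy
  obtain ⟨a, rfl⟩ := Ideal.mem_span_singleton'.1 hx
  obtain ⟨b, rfl⟩ := Ideal.mem_span_singleton'.1 hy
  rw [mul_assoc, ← mul_assoc (youngSymmetrizer R), h, mul_zero]

/-- If the symmetrizer `c` kills `N` from the left, then `N` squares to zero and vanishes. Otherwise
`c * N` lies in `N` and contains an element of the form `c * a * c`, a nonzero multiple of `c`. -/
theorem ideal_le_span_youngSymmetrizer {n : ℕ} (R : n.Partition) (N : Ideal (GroupAlg n))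
    (hN : N ≤ Ideal.span {youngSymmetrizer R}) :
    N = ⊥ ∨ N = Ideal.span {youngSymmetrizer R} := by
  by_cases h : ∀ x ∈ N, youngSymmetrizer R * x = 0
  · left
    apply ideal_eq_bot_of_mul_eq_zero
    intro x hx y hy
    obtain ⟨a, rfl⟩ := Ideal.mem_span_singleton'.1 (hN hx)
    rw [mul_assoc, h y hy, mul_zero]
  · right
    push Not at h
    obtain ⟨x, hx, hne⟩ := h
    obtain ⟨a, rfl⟩ := Ideal.mem_span_singleton'.1 (hN hx)
    obtain ⟨z, hz⟩ := youngSymmetrizer_mul_mul R a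
    rw [← mul_assoc, hz] at hne
    refine le_antisymm hN ((Ideal.span_singleton_le_iff_mem _).2 ?_)
    have h1 : z • youngSymmetrizer R ∈ N := by
      rw [← hz, mul_assoc]
      exact N.mul_mem_left _ hx
    have hz0 : z ≠ 0 := fun h0 => hne (by rw [h0, zero_smul])
    have h2 := N.smul_of_tower_mem z⁻¹ h1
    rwa [smul_smul, inv_mul_cancel₀ hz0, one_smul] at h2

theorem irrep_apply_coe {n : ℕ} (R : n.Partition) (g : Perm (Fin n)) (v : IrrepSpace R) :
    ((irrep R g v : IrrepSpace R) : GroupAlg n) = MonoidAlgebra.of ℂ _ g * (v : GroupAlg n) := by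
  simp [irrep, Representation.ofModule']

theorem irrep_apply {n : ℕ} (R : n.Partition) (g : Perm (Fin n)) (v : IrrepSpace R) :
    irrep R g v = MonoidAlgebra.of ℂ _ g • v := 
  Subtype.ext (irrep_apply_coe R g v)

instance irrep_isIrreducible {n : ℕ} (R : n.Partition) : (irrep R).IsIrreducible where
  exists_pair_ne := by
    refine ⟨⊥, ⊤, fun h => youngSymmetrizer_ne_zero R ?_⟩
    have h1 : (⟨_, Ideal.mem_span_singleton_self (youngSymmetrizer R)⟩ : IrrepSpace R) ∈
        (⊤ : Subrepresentation (irrep R)) := Submodule.mem_top (R := ℂ)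
    rw [← h] at h1
    exact congrArg Subtype.val ((Submodule.mem_bot ℂ).1 h1)
  eq_bot_or_eq_top σ := by
    have hsmul : ∀ (x : GroupAlg n) (v : IrrepSpace R), v ∈ σ → x • v ∈ σ := by
      intro x v hv
      induction x using MonoidAlgebra.induction_on with
      | of g =>
        rw [← irrep_apply]
        exact σ.apply_mem_toSubmodule g hv
      | add x y hx hy =>
        rw [add_smul]
        exact σ.toSubmodule.add_mem hx hy
      | smul r x hx =>
        rw [smul_assoc]
        exact σ.toSubmodule.smul_mem r hx
    let N' : Submodule (GroupAlg n) (IrrepSpace R) :=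
      { carrier := σ
        add_mem' := σ.toSubmodule.add_mem
        zero_mem' := σ.toSubmodule.zero_mem
        smul_mem' := hsmul }
    rcases ideal_le_span_youngSymmetrizer R (N'.map (Submodule.subtype _))
      (Submodule.map_subtype_le _ _) with h | h
    · left
      rw [eq_bot_iff]
      intro v hv
      have h1 : (v : GroupAlg n) ∈ N'.map (Submodule.subtype _) := ⟨v, hv, rfl⟩
      rw [h] at h1
      exact (Submodule.mem_bot ℂ).2 (Subtype.ext ((Submodule.mem_bot _).1 h1))
    · right
      rw [eq_top_iff]
      intro v _
      have h1 : (v : GroupAlg n) ∈ N'.map (Submodule.subtype _) := by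
        rw [h]
        exact v.2
      obtain ⟨w, hw, hwv⟩ := h1
      rw [← Subtype.ext hwv]
      exact hw

theorem intertwining_smul {n : ℕ} {R S : n.Partition}
    (f : Representation.IntertwiningMap (irrep R) (irrep S)) (x : GroupAlg n) (v : IrrepSpace R) :
    f (x • v) = x • f v := by
  induction x using MonoidAlgebra.induction_on with
  | of g => rw [← irrep_apply, ← irrep_apply, f.isIntertwining]
  | add x y hx hy => rw [add_smul, map_add, hx, hy, add_smul]
  | smul r x hx => rw [smul_assoc, map_smul, hx, smul_assoc]

/-- Some `v` in `V_R` is not killed by the symmetrizer of `R`, hence neither is `φ v`, a left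
multiple of the symmetrizer of `S`. So some product `rowSum R * x * colSum S` is nonzero, which
forces dominance; the inverse of `φ` gives the other direction. -/
theorem card_colOf_lt_le_of_equiv {n : ℕ} {R S : n.Partition}
    (φ : Representation.Equiv (irrep R) (irrep S)) (j : ℕ) :
    (Finset.univ.filter fun k => colOf S k < j).card ≤
      (Finset.univ.filter fun k => colOf R k < j).card := by
  obtain ⟨x, hx⟩ := exists_youngSymmetrizer_mul_mul_ne_zero R
  let v : IrrepSpace R := x • ⟨_, Ideal.mem_span_singleton_self (youngSymmetrizer R)⟩
  have hv : youngSymmetrizer R • v ≠ 0 := by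
    intro h
    apply hx
    have := congrArg Subtype.val h
    simpa [v, mul_assoc] using this
  have hφ : youngSymmetrizer R • φ v ≠ 0 := by
    intro h
    apply hv
    have h1 := intertwining_smul φ.toIntertwiningMap (youngSymmetrizer R) v
    have h2 : φ (youngSymmetrizer R • v) = youngSymmetrizer R • φ v := h1
    rw [h] at h2
    exact (map_eq_zero_iff φ φ.injective).1 h2
  obtain ⟨y, hy⟩ := Ideal.mem_span_singleton'.1 (φ v).2
  refine card_colOf_lt_le_of_ne_zero (x := colSum R * y * rowSum S) (fun h0 => hφ ?_) j
  apply Subtype.ext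
  show youngSymmetrizer R * (φ v : GroupAlg n) = 0
  rw [← hy, youngSymmetrizer_eq, youngSymmetrizer_eq]
  simp only [mul_assoc] at h0 ⊢
  exact h0

theorem eq_of_irrep_equiv {n : ℕ} {R S : n.Partition}
    (φ : Representation.Equiv (irrep R) (irrep S)) : R = S :=
  partition_ext_of_card_colOf_lt fun j =>
    le_antisymm (card_colOf_lt_le_of_equiv φ.symm j) (card_colOf_lt_le_of_equiv φ j)

/-! ### Cycle types as partitions -/

/-- The total `d` recovers the number of ones. This bridges `Perm.cycleType`, which omits fixed
points, and partitions of `d`. -/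
theorem partition_ext_of_filter {d : ℕ} {p q : d.Partition}
    (h : p.parts.filter (2 ≤ ·) = q.parts.filter (2 ≤ ·)) : p = q := by
  have hsum : ∀ m : Multiset ℕ, (∀ x ∈ m, 0 < x) →
      m.sum = (m.filter (2 ≤ ·)).sum + m.count 1 := by
    intro m hm
    induction m using Multiset.induction_on with
    | empty => simp
    | cons a m ih =>
      have ih := ih fun x hx => hm x (Multiset.mem_cons_of_mem hx)
      have ha := hm a (Multiset.mem_cons_self a m)
      rw [Multiset.sum_cons, Multiset.filter_cons, Multiset.sum_add, Multiset.count_cons, ih]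
      split_ifs <;> simp <;> omega
  have h1 := hsum p.parts fun x hx => p.parts_pos hx
  have h2 := hsum q.parts fun x hx => q.parts_pos hx
  rw [p.parts_sum] at h1
  rw [q.parts_sum] at h2
  rw [h] at h1
  ext j
  by_cases hj : 2 ≤ j
  · have := congrArg (Multiset.count j) h
    rwa [Multiset.count_filter_of_pos hj, Multiset.count_filter_of_pos hj] at this
  · obtain rfl | rfl : j = 0 ∨ j = 1 := by omega
    · rw [Multiset.count_eq_zero_of_notMem, Multiset.count_eq_zero_of_notMem]
      · exact fun h0 => (q.parts_pos h0).ne' rfl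
      · exact fun h0 => (p.parts_pos h0).ne' rfl
    · omega

/-- The cycle type of a permutation, fixed points included, as a partition of `d`. -/
def permType {d : ℕ} (α : Perm (Fin d)) : d.Partition where
  parts := α.partition.parts
  parts_pos := α.partition.parts_pos
  parts_sum := by rw [α.partition.parts_sum, Fintype.card_fin]

theorem filter_permType_parts {d : ℕ} (α : Perm (Fin d)) :
    (permType α).parts.filter (2 ≤ ·) = α.cycleType := Perm.filter_parts_partition_eq_cycleType

theorem permType_eq_iff {d : ℕ} (α : Perm (Fin d)) (p : d.Partition) :
    permType α = p ↔ α.cycleType = p.parts.filter (2 ≤ ·) := by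
  rw [← filter_permType_parts]
  exact ⟨fun h => by rw [h], partition_ext_of_filter⟩

theorem permType_eq_permType_iff {d : ℕ} (α β : Perm (Fin d)) :
    permType α = permType β ↔ IsConj α β := by
  rw [permType_eq_iff, filter_permType_parts, Perm.isConj_iff_cycleType_eq]

theorem permType_surjective (d : ℕ) : Function.Surjective (permType (d := d)) := by
  intro p
  have : ∃ α : Perm (Fin d), α.cycleType = p.parts.filter (2 ≤ ·) := by
    rw [Perm.exists_with_cycleType_iff]
    refine ⟨?_, fun a ha => (Multiset.mem_filter.1 ha).2⟩
    rw [Fintype.card_fin]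
    conv_rhs => rw [← p.parts_sum]
    rw [← Multiset.sum_filter_add_sum_filter_not (s := p.parts) (2 ≤ ·)]
    exact Nat.le_add_right _ _
  obtain ⟨α, hα⟩ := this
  exact ⟨α, (permType_eq_iff α p).2 hα⟩

/-! ### Orthogonality of characters -/

theorem chi_eq_of_isConj {n : ℕ} (R : n.Partition) {g h : Perm (Fin n)} (hc : IsConj g h) :
    chi R g = chi R h := by
  obtain ⟨s, rfl⟩ := isConj_iff.1 hc
  exact ((irrep R).char_conj g s).symm

theorem isConj_inv {n : ℕ} (g : Perm (Fin n)) : IsConj g⁻¹ g := by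
  rw [Perm.isConj_iff_cycleType_eq, Perm.cycleType_inv]

theorem chi_inv {n : ℕ} (R : n.Partition) (g : Perm (Fin n)) : chi R g⁻¹ = chi R g :=
  chi_eq_of_isConj R (isConj_inv g)

theorem factorial_ne_zero_complex (n : ℕ) : (n.factorial : ℂ) ≠ 0 :=
  Nat.cast_ne_zero.2 n.factorial_ne_zero

theorem natCard_perm (n : ℕ) : Nat.card (Perm (Fin n)) = n.factorial := by
  rw [Nat.card_eq_fintype_card, Fintype.card_perm, Fintype.card_fin]

noncomputable instance (n : ℕ) : Invertible (Nat.card (Perm (Fin n)) : ℂ) :=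
  invertibleOfNonzero (by rw [natCard_perm]; exact factorial_ne_zero_complex n)

theorem sum_chi_mul_chi {n : ℕ} (R S : n.Partition) :
    ∑ g : Perm (Fin n), chi R g * chi S g = if R = S then (n.factorial : ℂ) else 0 := by
  classical
  have h := Representation.char_orthonormal (irrep R) (irrep S)
  have h1 : ∀ g, (irrep R).character g * (irrep S).character g⁻¹ = chi R g * chi S g := fun g => by
    rw [← chi_inv S g]
    rfl
  simp only [h1, natCard_perm] at h
  rw [inv_mul_eq_iff_eq_mul₀ (factorial_ne_zero_complex n)] at h
  rw [h]
  by_cases hRS : R = S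
  · subst hRS
    rw [if_pos ⟨Representation.Equiv.refl _⟩, if_pos rfl, mul_one]
  · rw [if_neg fun ⟨φ⟩ => hRS (eq_of_irrep_equiv φ).symm, if_neg hRS, mul_zero]

/-- The number of `s` conjugating `g` to `h`. -/
def conjCount {n : ℕ} (g h : Perm (Fin n)) : ℕ :=
  (Finset.univ.filter fun s : Perm (Fin n) => s * g * s⁻¹ = h).card

/-- The number of permutations of cycle type `p`. -/
def typeCount {n : ℕ} (p : n.Partition) : ℕ :=
  (Finset.univ.filter fun g : Perm (Fin n) => permType g = p).card

theorem typeCount_pos {n : ℕ} (p : n.Partition) : 0 < typeCount p := by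
  obtain ⟨g, hg⟩ := permType_surjective n p
  exact Finset.card_pos.2 ⟨g, by simp [hg]⟩

/-- Orbit counting for `s ↦ s * g * s⁻¹`: the fibres over the class of `g` all have the same size,
and they partition the group. -/
theorem typeCount_mul_conjCount {n : ℕ} (g h : Perm (Fin n)) :
    typeCount (permType g) * conjCount g h = if permType g = permType h then n.factorial else 0 := by
  classical
  have hconst : ∀ h, IsConj g h → conjCount g h = conjCount g g := by
    intro h hc
    obtain ⟨t, rfl⟩ := isConj_iff.1 hc
    refine Finset.card_bij' (fun s _ => t⁻¹ * s) (fun s _ => t * s) ?_ ?_ ?_ ?_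
    · intro s hs
      simp only [Finset.mem_filter, Finset.mem_univ, true_and] at hs ⊢
      rw [mul_inv_rev, inv_inv, mul_assoc t⁻¹ s g, ← mul_assoc, mul_assoc t⁻¹ (s * g) s⁻¹, hs]
      group
    · intro s hs
      simp only [Finset.mem_filter, Finset.mem_univ, true_and] at hs ⊢
      have h1 : t * s * g * (t * s)⁻¹ = t * (s * g * s⁻¹) * t⁻¹ := by group
      rw [h1, hs]
    · simp
    · simp
  split_ifs with hgh
  · rw [hconst h ((permType_eq_permType_iff g h).1 hgh), typeCount, ← smul_eq_mul,
      ← Finset.sum_const, ← natCard_perm, Nat.card_eq_fintype_card, ← Finset.card_univ,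
      Finset.card_eq_sum_card_fiberwise (f := fun s => s * g * s⁻¹)
        (t := Finset.univ.filter fun x => permType x = permType g)]
    · refine Finset.sum_congr rfl fun x hx => ?_
      rw [← hconst x]
      · rfl
      · rw [← permType_eq_permType_iff, (Finset.mem_filter.1 hx).2]
    · intro s _
      simp only [Finset.coe_filter, Finset.mem_univ, true_and, Set.mem_ofPred_eq]
      rw [eq_comm, permType_eq_permType_iff, isConj_iff]
      exact ⟨s, rfl⟩
  · rw [conjCount, Finset.card_eq_zero.2, mul_zero]
    rw [Finset.filter_eq_empty_iff]
    intro s _ hs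
    exact hgh ((permType_eq_permType_iff g h).2 (isConj_iff.2 ⟨s, hs⟩))

/-- Row orthogonality, summed over classes, says that the character table `M` has the right inverse
`N`. Both matrices are square, indexed by partitions, so `N * M = 1` as well, and its entries are
the column relations. -/
theorem sum_partition_chi_mul_chi {n : ℕ} (g h : Perm (Fin n)) :
    ∑ R : n.Partition, chi R g * chi R h = conjCount g h := by
  classical
  obtain ⟨s, hs⟩ := (permType_surjective n).hasRightInverse
  have hchi : ∀ R g, chi R (s (permType g)) = chi R g := fun R g =>
    chi_eq_of_isConj R ((permType_eq_permType_iff _ _).1 (hs _))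
  let M : Matrix n.Partition n.Partition ℂ := fun R p => chi R (s p)
  let N : Matrix n.Partition n.Partition ℂ := fun p R =>
    (n.factorial : ℂ)⁻¹ * ((typeCount p : ℂ) * chi R (s p))
  have hMN : M * N = 1 := by
    ext R S
    rw [Matrix.mul_apply, Matrix.one_apply]
    have h1 := sum_chi_mul_chi R S
    rw [← Finset.sum_fiberwise (s := Finset.univ) (g := permType)] at h1
    have h2 : ∀ p : n.Partition, ∑ g : Perm (Fin n) with permType g = p, chi R g * chi S g =
        (typeCount p : ℂ) * (chi R (s p) * chi S (s p)) := by
      intro p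
      rw [typeCount, ← nsmul_eq_mul, ← Finset.sum_const]
      refine Finset.sum_congr rfl fun g hg => ?_
      rw [← (Finset.mem_filter.1 hg).2, hchi, hchi]
    simp only [h2] at h1
    calc ∑ p, M R p * N p S
        = (n.factorial : ℂ)⁻¹ * ∑ p, (typeCount p : ℂ) * (chi R (s p) * chi S (s p)) := by
          rw [Finset.mul_sum]
          refine Finset.sum_congr rfl fun p _ => ?_
          simp only [M, N]
          ring
      _ = _ := by
          rw [h1]
          split_ifs
          · rw [inv_mul_cancel₀ (factorial_ne_zero_complex n)]
          · rw [mul_zero]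
  have hNM := mul_eq_one_comm.1 hMN
  have h3 := congrFun (congrFun hNM (permType g)) (permType h)
  rw [Matrix.mul_apply, Matrix.one_apply] at h3
  have h4 : ∑ R, N (permType g) R * M R (permType h) =
      (n.factorial : ℂ)⁻¹ * ((typeCount (permType g) : ℂ) * ∑ R, chi R g * chi R h) := by
    rw [Finset.mul_sum, Finset.mul_sum]
    refine Finset.sum_congr rfl fun R _ => ?_
    simp only [M, N, hchi]
    ring
  rw [h4, inv_mul_eq_iff_eq_mul₀ (factorial_ne_zero_complex n)] at h3
  have h5 : (typeCount (permType g) : ℂ) ≠ 0 := Nat.cast_ne_zero.2 (typeCount_pos _).ne'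
  apply mul_left_cancel₀ h5
  rw [h3, ← Nat.cast_mul, typeCount_mul_conjCount]
  split_ifs <;> simp

/-! ### Cycles of a permutation and twisted-invariant families -/

theorem sameCycle_out {d : ℕ} {α : Perm (Fin d)} (i : Fin d) :
    α.SameCycle (Quotient.mk _ i : Cycles α).out i :=
  Quotient.exact (s := Perm.SameCycle.setoid α) (Quotient.out_eq (Quotient.mk _ i : Cycles α))

theorem mk_eq_iff_sameCycle {d : ℕ} {α : Perm (Fin d)} (i : Fin d) (a : Cycles α) :
    (Quotient.mk _ i : Cycles α) = a ↔ α.SameCycle a.out i := by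
  constructor
  · rintro rfl
    exact sameCycle_out i
  · intro h
    rw [← Quotient.out_eq a]
    exact Quotient.sound (s := Perm.SameCycle.setoid α) h.symm

theorem cycleLength_eq_minimalPeriod {d : ℕ} {α : Perm (Fin d)} (a : Cycles α) :
    cycleLength a = Function.minimalPeriod (α • ·) a.out := by
  classical
  rw [MulAction.minimalPeriod_eq_card, ← Nat.card_eq_fintype_card, cycleLength]
  refine Nat.card_congr (Equiv.subtypeEquivRight fun i => ?_)
  rw [mk_eq_iff_sameCycle, MulAction.mem_orbit_iff]
  constructor
  · rintro ⟨k, hk⟩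
    exact ⟨⟨α ^ k, k, rfl⟩, hk⟩
  · rintro ⟨⟨_, k, rfl⟩, hk⟩
    exact ⟨k, hk⟩

theorem zpow_apply_out_eq_iff {d : ℕ} {α : Perm (Fin d)} (a : Cycles α) (k : ℤ) :
    (α ^ k) a.out = a.out ↔ (cycleLength a : ℤ) ∣ k := by
  rw [cycleLength_eq_minimalPeriod, ← MulAction.zpow_smul_eq_iff_minimalPeriod_dvd, Perm.smul_def]

/-- A family twisted-invariant along `α` is determined by its value at one point of each cycle,
which is any point fixed by the power of the twist that belongs to the length of the cycle. -/
theorem card_twisted_invariant {X : Type*} [Fintype X] [DecidableEq X] {d : ℕ} (α : Perm (Fin d))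
    (T : Perm X) :
    (Finset.univ.filter fun s : Fin d → X => ∀ i, s i = T (s (α i))).card =
      ∏ a : Cycles α, (Finset.univ.filter fun x : X => (T ^ cycleLength a) x = x).card := by
  classical
  rw [← Fintype.card_piFinset]
  have hiter : ∀ s : Fin d → X, (∀ i, s i = T (s (α i))) →
      ∀ (k : ℤ) (i : Fin d), s i = (T ^ k) (s ((α ^ k) i)) := by
    intro s hs k
    induction k using Int.induction_on with
    | zero => simp
    | succ k ih =>
      intro i
      rw [ih i, hs ((α ^ (k : ℤ)) i), ← Perm.mul_apply, ← zpow_add_one, ← Perm.mul_apply,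
        ← zpow_one_add, add_comm 1]
    | pred k ih =>
      intro i
      have h1 : (α ^ (-(k : ℤ))) i = α ((α ^ (-(k : ℤ) - 1)) i) := by
        rw [← Perm.mul_apply, ← zpow_one_add]
        congr 2
        ring
      have h2 := hs ((α ^ (-(k : ℤ) - 1)) i)
      rw [ih i, h1, h2]
      have h3 : T ^ (-(k : ℤ)) = T ^ (-(k : ℤ) - 1) * T := by
        rw [← zpow_add_one, sub_add_cancel]
      rw [h3, Perm.mul_apply]
  refine Finset.card_bij (fun s _ a => s a.out) ?_ ?_ ?_
  · intro s hs
    simp only [Finset.mem_filter, Finset.mem_univ, true_and, Fintype.mem_piFinset] at hs ⊢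
    intro a
    have h1 := hiter s hs (cycleLength a) a.out
    rw [(zpow_apply_out_eq_iff a _).2 dvd_rfl, zpow_natCast] at h1
    exact h1.symm
  · intro s hs t ht hst
    simp only [Finset.mem_filter, Finset.mem_univ, true_and] at hs ht
    funext i
    obtain ⟨k, hk⟩ := (sameCycle_out (α := α) i).symm
    rw [hiter s hs k i, hiter t ht k i, hk]
    exact congrArg _ (congrFun hst _)
  · intro x hx
    simp only [Finset.mem_filter, Finset.mem_univ, true_and, Fintype.mem_piFinset] at hx
    have hdvd : ∀ (a : Cycles α) (k : ℤ), (α ^ k) a.out = a.out → (T ^ k) (x a) = x a := by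
      intro a k hk
      obtain ⟨m, rfl⟩ := (zpow_apply_out_eq_iff a k).1 hk
      rw [zpow_mul, zpow_natCast]
      exact Perm.zpow_apply_eq_self_of_apply_eq_self (hx a) m
    -- Each `i` is carried to the representative of its cycle by `α ^ k i`, so the family must be `T
    -- ^ k i` applied to the chosen value. By `hval` the exponent does not matter: two choices
    -- differ by a multiple of the cycle length.
    choose k hk using fun i => (sameCycle_out (α := α) i).symm
    have hval : ∀ (i : Fin d) (e : ℤ), (α ^ e) i = (Quotient.mk _ i : Cycles α).out →
        (T ^ e) (x (Quotient.mk _ i)) = (T ^ k i) (x (Quotient.mk _ i)) := by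
      intro i e he
      have h1 : (α ^ (e - k i)) (Quotient.mk _ i : Cycles α).out =
          (Quotient.mk _ i : Cycles α).out := by
        conv_lhs => rw [← hk i]
        rw [← Perm.mul_apply, ← zpow_add, sub_add_cancel, he]
      have h2 := hdvd _ _ h1
      conv_rhs => rw [← h2]
      rw [← Perm.mul_apply, ← zpow_add, add_sub_cancel]
    refine ⟨fun i => (T ^ k i) (x (Quotient.mk _ i)), ?_, ?_⟩
    · simp only [Finset.mem_filter, Finset.mem_univ, true_and]
      intro i
      have hq : (Quotient.mk _ (α i) : Cycles α) = Quotient.mk _ i :=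
        Quotient.sound (s := Perm.SameCycle.setoid α) ⟨-1, by simp⟩
      have h3 := hk (α i)
      rw [hq] at h3 ⊢
      rw [← Perm.mul_apply, ← zpow_one_add, add_comm, ← hval i]
      rw [zpow_add_one, Perm.mul_apply, h3]
    · funext a
      have h4 : (Quotient.mk _ a.out : Cycles α) = a := Quotient.out_eq a
      have h5 := hval a.out 0 (by rw [h4]; simp)
      refine h5.symm.trans ?_
      rw [h4, zpow_zero, Perm.one_apply]

theorem sum_cycleLength {d : ℕ} (α : Perm (Fin d)) : ∑ a : Cycles α, cycleLength a = d := by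
  classical
  have := Finset.card_eq_sum_card_fiberwise (s := (Finset.univ : Finset (Fin d)))
    (t := (Finset.univ : Finset (Cycles α))) (f := fun i => Quotient.mk _ i) (fun i _ => by simp)
  rw [Finset.card_univ, Fintype.card_fin] at this
  refine Eq.trans (Finset.sum_congr rfl fun a _ => ?_) this.symm
  rw [cycleLength, Nat.card_eq_fintype_card, Fintype.card_subtype]

theorem cycleLength_pos {d : ℕ} {α : Perm (Fin d)} (a : Cycles α) : 0 < cycleLength a :=
  have : Nonempty {i : Fin d // (Quotient.mk _ i : Cycles α) = a} := ⟨a.out, Quotient.out_eq a⟩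
  Nat.card_pos

theorem card_support_cycleOf_out {d : ℕ} {α : Perm (Fin d)} {a : Cycles α}
    (h : a.out ∈ α.support) : (α.cycleOf a.out).support.card = cycleLength a := by
  classical
  rw [cycleLength, Nat.card_eq_fintype_card, Fintype.card_subtype]
  congr 1
  ext i
  simp only [Perm.mem_support_cycleOf_iff, h, and_true, Finset.mem_filter, Finset.mem_univ,
    true_and, mk_eq_iff_sameCycle]

theorem two_le_cycleLength_iff {d : ℕ} {α : Perm (Fin d)} (a : Cycles α) :
    2 ≤ cycleLength a ↔ a.out ∈ α.support := by
  constructor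
  · intro h
    by_contra hs
    have h1 := (zpow_apply_out_eq_iff a 1).1 (by simpa using hs)
    have := Int.le_of_dvd one_pos h1
    omega
  · intro h
    rw [← card_support_cycleOf_out h, Perm.two_le_card_support_cycleOf_iff]
    simpa using h

/-- The parts of the cycle type are the lengths of the cycles. -/
theorem permType_parts_eq_map {d : ℕ} (α : Perm (Fin d)) :
    (permType α).parts = Finset.univ.val.map (cycleLength (α := α)) := by
  classical
  let q : d.Partition :=
    { parts := Finset.univ.val.map (cycleLength (α := α))
      parts_pos := by
        intro i hi
        obtain ⟨a, _, rfl⟩ := Multiset.mem_map.1 hi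
        exact cycleLength_pos a
      parts_sum := sum_cycleLength α }
  suffices h : permType α = q by rw [h]
  -- Both sides are partitions of `d`, so only parts at least two need comparing, and those belong
  -- to the cyclic factors of `α`.
  rw [permType_eq_iff]
  show α.cycleType = Multiset.filter _ (Multiset.map _ _)
  rw [Multiset.filter_map, Perm.cycleType_def]
  symm
  refine Multiset.map_eq_map_of_bij_of_nodup _ _ (Finset.univ.nodup.filter _)
    α.cycleFactorsFinset.nodup (fun a _ => α.cycleOf a.out) ?_ ?_ ?_ ?_
  · intro a ha
    exact Perm.cycleOf_mem_cycleFactorsFinset_iff.2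
      ((two_le_cycleLength_iff a).1 (Multiset.mem_filter.1 ha).2)
  · intro a ha b hb hab
    have ha' := (two_le_cycleLength_iff a).1 (Multiset.mem_filter.1 ha).2
    have hb' := (two_le_cycleLength_iff b).1 (Multiset.mem_filter.1 hb).2
    have h1 : b.out ∈ (α.cycleOf a.out).support := by
      rw [hab, Perm.mem_support_cycleOf_iff]
      exact ⟨Perm.SameCycle.refl _ _, hb'⟩
    rw [Perm.mem_support_cycleOf_iff, ← mk_eq_iff_sameCycle] at h1
    rw [← h1.1, Quotient.out_eq]
  · intro c hc'
    have hc : c ∈ α.cycleFactorsFinset := hc'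
    obtain ⟨x, hx⟩ := (Perm.mem_cycleFactorsFinset_iff.1 hc).1.nonempty_support
    have h1 := Perm.cycle_is_cycleOf hx hc
    have h2 : x ∈ α.support := by
      rw [← Perm.cycleOf_mem_cycleFactorsFinset_iff, ← h1]
      exact hc
    have h3 := (sameCycle_out (α := α) x).cycleOf_eq
    refine ⟨Quotient.mk _ x, ?_, h3.trans h1.symm⟩
    rw [Multiset.mem_filter]
    refine ⟨Finset.mem_univ _, (two_le_cycleLength_iff _).2 ?_⟩
    rw [← Perm.cycleOf_mem_cycleFactorsFinset_iff, h3, ← h1]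
    exact hc
  · intro a ha
    exact (card_support_cycleOf_out ((two_le_cycleLength_iff a).1 (Multiset.mem_filter.1 ha).2)).symm

theorem prod_cycles_eq_prod_pow {M : Type*} [CommMonoid M] {d : ℕ} (α : Perm (Fin d)) (F : ℕ → M) :
    ∏ a : Cycles α, F (cycleLength a) =
      ∏ i : Fin d, F (i.val + 1) ^ (permType α).parts.count (i.val + 1) := by
  classical
  have h1 : ∏ a : Cycles α, F (cycleLength a) = ((permType α).parts.map F).prod := by
    rw [permType_parts_eq_map, Multiset.map_map]
    rfl
  rw [h1, Finset.prod_multiset_map_count]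
  have h2 : ∏ i : Fin d, F (i.val + 1) ^ (permType α).parts.count (i.val + 1) =
      ∏ i ∈ Finset.range d, F (i + 1) ^ (permType α).parts.count (i + 1) :=
    Fin.prod_univ_eq_prod_range (fun i => F (i + 1) ^ (permType α).parts.count (i + 1)) d
  rw [h2, Finset.range_eq_Ico,
    Finset.prod_Ico_add' (fun i => F i ^ (permType α).parts.count i) 0 d 1]
  refine Finset.prod_subset ?_ ?_
  · intro x hx
    rw [Multiset.mem_toFinset] at hx
    have := (permType α).parts_pos hx
    have := (permType α).le_of_mem_parts hx
    simp
    omega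
  · intro x _ hx
    rw [Multiset.mem_toFinset] at hx
    rw [Multiset.count_eq_zero_of_notMem hx, pow_zero]

/-! ### Fixed tuples and character sums -/

/-- The number of tuples fixed by a permutation of the colours and a left and a right diagonal
multiplication. -/
def fixCount (n : ℕ) {d : ℕ} (α : Perm (Fin d)) (γ₁ γ₂ : Perm (Fin n)) : ℕ :=
  (Finset.univ.filter fun s : Fin d → Perm (Fin n) => ∀ i, s i = γ₁ * s (α i) * γ₂).card

/-- The condition says that `x` conjugates `h` to `g⁻¹`, so column orthogonality counts the
solutions; the inverse disappears because permutations are conjugate to their inverses. -/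
theorem card_mul_mul_eq_self {n : ℕ} (g h : Perm (Fin n)) :
    ((Finset.univ.filter fun x : Perm (Fin n) => g * x * h = x).card : ℂ) =
      ∑ R : n.Partition, chi R g * chi R h := by
  have h1 : ∑ R : n.Partition, chi R g * chi R h = ∑ R : n.Partition, chi R h * chi R g⁻¹ :=
    Finset.sum_congr rfl fun R _ => by rw [chi_inv, mul_comm]
  rw [h1, sum_partition_chi_mul_chi, conjCount]
  congr 2
  ext x
  simp only [Finset.mem_filter, Finset.mem_univ, true_and]
  rw [mul_assoc, ← eq_inv_mul_iff_mul_eq, mul_inv_eq_iff_eq_mul]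

theorem fixCount_eq_prod (n : ℕ) {d : ℕ} (α : Perm (Fin d)) (γ₁ γ₂ : Perm (Fin n)) :
    (fixCount n α γ₁ γ₂ : ℂ) = ∏ a : Cycles α, ∑ R : n.Partition,
      chi R (γ₁ ^ cycleLength a) * chi R (γ₂ ^ cycleLength a) := by
  classical
  let T : Perm (Perm (Fin n)) := Equiv.mulLeft γ₁ * Equiv.mulRight γ₂
  have hT : ∀ x, T x = γ₁ * x * γ₂ := fun x => (mul_assoc γ₁ x γ₂).symm
  have hTk : ∀ (k : ℕ) x, (T ^ k) x = γ₁ ^ k * x * γ₂ ^ k := by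
    intro k
    induction k with
    | zero => simp
    | succ k ih =>
      intro x
      rw [pow_succ', Perm.mul_apply, ih, hT, pow_succ' γ₁, pow_succ γ₂]
      simp only [mul_assoc]
  have h1 := card_twisted_invariant α T
  simp only [hT, hTk] at h1
  rw [fixCount, h1, Nat.cast_prod]
  exact Finset.prod_congr rfl fun a _ => card_mul_mul_eq_self _ _

theorem permCharSum_eq_sum_fixCount (n : ℕ) {d : ℕ} (α : Perm (Fin d)) :
    permCharSum n α = ∑ σ₁ : Perm (Fin n), ∑ σ₂ : Perm (Fin n), (fixCount n α σ₁ σ₂ : ℂ) := by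
  classical
  rw [permCharSum, Finset.sum_comm]
  refine Finset.sum_congr rfl fun σ₁ _ => ?_
  rw [Finset.sum_comm]
  refine Finset.sum_congr rfl fun σ₂ _ => ?_
  rw [fixCount_eq_prod, Fintype.prod_sum, ← Finset.sum_filter]
  -- After expansion the sum runs over functions on the set of cycles; these are the families
  -- constant on cycles.
  refine Finset.sum_bij' (fun R _ a => R a.out) (fun Q _ i => Q (Quotient.mk _ i)) ?_ ?_ ?_ ?_ ?_
  · simp
  · intro Q _
    simp only [Finset.mem_filter, Finset.mem_univ, true_and]
    intro i j hij
    exact congrArg Q (Quotient.sound (s := Perm.SameCycle.setoid α) hij)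
  · intro R hR
    funext i
    exact (Finset.mem_filter.1 hR).2 _ _ (sameCycle_out i)
  · intro Q _
    funext a
    exact congrArg Q (Quotient.out_eq a)
  · intro R _
    rfl

theorem partitionCharSum_permType (n : ℕ) {d : ℕ} (α : Perm (Fin d)) :
    partitionCharSum n (permType α) =
      ∑ σ₁ : Perm (Fin n), ∑ σ₂ : Perm (Fin n), (fixCount n α σ₁ σ₂ : ℂ) := by
  classical
  rw [partitionCharSum, Finset.sum_comm]
  refine Finset.sum_congr rfl fun σ₁ _ => ?_
  rw [Finset.sum_comm]
  refine Finset.sum_congr rfl fun σ₂ _ => ?_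
  rw [fixCount_eq_prod, prod_cycles_eq_prod_pow α
    (fun l => ∑ R : n.Partition, chi R (σ₁ ^ l) * chi R (σ₂ ^ l))]
  have h1 : ∀ i : Fin d, (∑ R : n.Partition, chi R (σ₁ ^ (i.val + 1)) * chi R (σ₂ ^ (i.val + 1))) ^
      (permType α).parts.count (i.val + 1) =
      ∑ Q : Fin ((permType α).parts.count (i.val + 1)) → n.Partition,
        ∏ j, chi (Q j) (σ₁ ^ (i.val + 1)) * chi (Q j) (σ₂ ^ (i.val + 1)) := by
    intro i
    have h2 := Fintype.prod_sum fun (_ : Fin ((permType α).parts.count (i.val + 1)))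
      (R : n.Partition) => chi R (σ₁ ^ (i.val + 1)) * chi R (σ₂ ^ (i.val + 1))
    rw [← h2, Finset.prod_const, Finset.card_univ, Fintype.card_fin]
  simp only [h1]
  rw [Fintype.prod_sum]

theorem permCharSum_eq_partitionCharSum (n : ℕ) {d : ℕ} (α : Perm (Fin d)) :
    permCharSum n α = partitionCharSum n (permType α) := by
  rw [permCharSum_eq_sum_fixCount, partitionCharSum_permType]

/-! ### The size of a conjugacy class -/

theorem count_one_add_sum_filter {d : ℕ} (p : d.Partition) :
    (p.parts.filter (2 ≤ ·)).sum + p.parts.count 1 = d := by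
  conv_rhs => rw [← p.parts_sum]
  rw [← Multiset.sum_filter_add_sum_filter_not (s := p.parts) (2 ≤ ·)]
  congr 1
  have h : p.parts.filter (fun x => ¬ 2 ≤ x) = Multiset.replicate (p.parts.count 1) 1 := by
    rw [← Multiset.filter_eq']
    refine Multiset.filter_congr fun x hx => ?_
    have := p.parts_pos hx
    omega
  rw [h, Multiset.sum_replicate, smul_eq_mul, mul_one]

/-- `Perm.card_of_cycleType_mul_eq` treats fixed points by a separate factorial. This puts the part
`1` back among the indices, while `F i 0 = 1` takes care of sizes that do not occur. -/
theorem prod_filter_two_le_mul {d : ℕ} (p : d.Partition) (F : ℕ → ℕ → ℕ) (hF : ∀ i, F i 0 = 1) :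
    (∏ i ∈ (p.parts.filter (2 ≤ ·)).toFinset, F i ((p.parts.filter (2 ≤ ·)).count i)) *
      F 1 (p.parts.count 1) = ∏ i ∈ Finset.Icc 1 d, F i (p.parts.count i) := by
  classical
  have hext : ∏ i ∈ p.parts.toFinset, F i (p.parts.count i) =
      ∏ i ∈ Finset.Icc 1 d, F i (p.parts.count i) := by
    refine Finset.prod_subset ?_ ?_
    · intro x hx
      rw [Multiset.mem_toFinset] at hx
      have := p.parts_pos hx
      have := p.le_of_mem_parts hx
      rw [Finset.mem_Icc]
      omega
    · intro x _ hx
      rw [Multiset.mem_toFinset] at hx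
      rw [Multiset.count_eq_zero_of_notMem hx, hF]
  rw [← hext]
  by_cases h1 : 1 ∈ p.parts
  · rw [← Finset.prod_erase_mul _ _ (Multiset.mem_toFinset.2 h1)]
    congr 1
    refine Finset.prod_congr ?_ ?_
    · ext i
      simp only [Multiset.mem_toFinset, Multiset.mem_filter, Finset.mem_erase]
      constructor
      · rintro ⟨hi, h2⟩
        exact ⟨by omega, hi⟩
      · rintro ⟨h2, hi⟩
        have := p.parts_pos hi
        exact ⟨hi, by omega⟩
    · intro i hi
      rw [Multiset.count_filter_of_pos]
      simp only [Finset.mem_erase, Multiset.mem_toFinset] at hi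
      have := p.parts_pos hi.2
      omega
  · have h2 : p.parts.filter (2 ≤ ·) = p.parts := by
      rw [Multiset.filter_eq_self]
      intro i hi
      have := p.parts_pos hi
      have : i ≠ 1 := fun h => h1 (h ▸ hi)
      omega
    rw [h2, Multiset.count_eq_zero_of_notMem h1, hF, mul_one]

theorem typeCount_mul_symFactor {d : ℕ} (p : d.Partition) :
    typeCount p * symFactor p = d.factorial := by
  classical
  have h := Perm.card_of_cycleType_mul_eq (Fin d) (p.parts.filter (2 ≤ ·))
  have hs := count_one_add_sum_filter p
  rw [if_pos ⟨by rw [Fintype.card_fin]; omega, fun a ha => (Multiset.mem_filter.1 ha).2⟩,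
    Fintype.card_fin] at h
  have h1 : typeCount p = (Finset.univ.filter fun g : Perm (Fin d) =>
      g.cycleType = p.parts.filter (2 ≤ ·)).card := by
    simp only [typeCount, permType_eq_iff]
  rw [h1, ← h]
  congr 1
  have h2 : d - (p.parts.filter (2 ≤ ·)).sum = p.parts.count 1 := by omega
  rw [h2, symFactor, ← prod_filter_two_le_mul p (fun i m => i ^ m * m.factorial) (by simp),
    Finset.prod_mul_distrib, ← Finset.prod_multiset_count]
  simp
  ring

/-- Sums of class functions over `S_d` as sums over cycle types. -/
theorem sum_perm_eq_sum_partition {d : ℕ} (F : d.Partition → ℂ) :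
    ∑ α : Perm (Fin d), F (permType α) =
      (d.factorial : ℂ) * ∑ p : d.Partition, 1 / (symFactor p : ℂ) * F p := by
  classical
  rw [← Finset.sum_fiberwise (s := Finset.univ) (g := permType), Finset.mul_sum]
  refine Finset.sum_congr rfl fun p _ => ?_
  have h1 : ∑ α : Perm (Fin d) with permType α = p, F (permType α) = (typeCount p : ℂ) * F p := by
    rw [typeCount, ← nsmul_eq_mul, ← Finset.sum_const]
    refine Finset.sum_congr rfl fun g hg => ?_
    rw [(Finset.mem_filter.1 hg).2]
  have h2 : (symFactor p : ℂ) ≠ 0 := by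
    intro h0
    have h3 := typeCount_mul_symFactor p
    rw [Nat.cast_eq_zero.1 h0, mul_zero] at h3
    exact d.factorial_ne_zero h3.symm
  rw [h1, ← typeCount_mul_symFactor p]
  push_cast
  field_simp

/-! ### Burnside's lemma -/

/-- The action on tuples by a permutation of the colours and by left and right diagonal
multiplication. -/
abbrev tupleAction (n d : ℕ) :
    MulAction (Perm (Fin d) × Perm (Fin n) × Perm (Fin n)) (Fin d → Perm (Fin n)) where
  smul g s := fun a => g.2.1 * s (g.1⁻¹ a) * g.2.2⁻¹
  one_smul s := by
    funext a
    show (1 : Perm (Fin n)) * s ((1 : Perm (Fin d))⁻¹ a) * (1 : Perm (Fin n))⁻¹ = s a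
    simp
  mul_smul g h s := by
    funext a
    show (g.2.1 * h.2.1) * s ((g.1 * h.1)⁻¹ a) * (g.2.2 * h.2.2)⁻¹ =
      g.2.1 * (h.2.1 * s (h.1⁻¹ (g.1⁻¹ a)) * h.2.2⁻¹) * g.2.2⁻¹
    rw [mul_inv_rev, mul_inv_rev, Perm.mul_apply]
    simp only [mul_assoc]

theorem numColourSymm_mul_eq_sum_fixCount (n d : ℕ) :
    numColourSymm n d * (d.factorial * n.factorial ^ 2) =
      ∑ α : Perm (Fin d), ∑ γ₁ : Perm (Fin n), ∑ γ₂ : Perm (Fin n), fixCount n α γ₁ γ₂ := by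
  classical
  let := tupleAction n d
  have hsmul : ∀ (g : Perm (Fin d) × Perm (Fin n) × Perm (Fin n)) (s : Fin d → Perm (Fin n)),
      g • s = fun a => g.2.1 * s (g.1⁻¹ a) * g.2.2⁻¹ := fun g s => rfl
  have horb : MulAction.orbitRel (Perm (Fin d) × Perm (Fin n) × Perm (Fin n))
      (Fin d → Perm (Fin n)) = colourSetoid n d := by
    ext s t
    rw [Setoid.comm', MulAction.orbitRel_apply, MulAction.mem_orbit_iff]
    constructor
    · rintro ⟨g, hg⟩
      refine ⟨g.1⁻¹, g.2.1, g.2.2⁻¹, fun a => ?_⟩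
      rw [← hg, hsmul]
    · rintro ⟨α, γ₁, γ₂, h⟩
      refine ⟨(α⁻¹, γ₁, γ₂⁻¹), ?_⟩
      rw [hsmul]
      funext a
      simp [h a]
  have hB := MulAction.sum_card_fixedBy_eq_card_orbits_mul_card_group
    (Perm (Fin d) × Perm (Fin n) × Perm (Fin n)) (Fin d → Perm (Fin n))
  rw [Fintype.card_prod, Fintype.card_prod, Fintype.card_perm, Fintype.card_perm, Fintype.card_fin,
    Fintype.card_fin, ← Nat.card_eq_fintype_card, ← pow_two] at hB
  have hN : numColourSymm n d = Nat.card (Quotient (MulAction.orbitRel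
      (Perm (Fin d) × Perm (Fin n) × Perm (Fin n)) (Fin d → Perm (Fin n)))) := by
    rw [numColourSymm, horb]
  rw [hN, ← hB, Fintype.sum_prod_type]
  -- The group action inverts `α` and `γ₂`, whereas `fixCount` does not; summing over the whole
  -- group allows reindexing by inverses.
  refine Fintype.sum_equiv (Equiv.inv _) _ _ fun α => ?_
  rw [Fintype.sum_prod_type]
  refine Finset.sum_congr rfl fun γ₁ _ => ?_
  refine Fintype.sum_equiv (Equiv.inv _) _ _ fun γ₂ => ?_
  rw [fixCount, ← Nat.card_eq_fintype_card, Nat.card_eq_card_toFinset]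
  congr 1
  ext s
  simp only [Set.mem_toFinset, MulAction.mem_fixedBy, hsmul, Finset.mem_filter, Finset.mem_univ,
    true_and, Equiv.inv_apply, funext_iff, eq_comm]

theorem numColourSymm_eq_sum_permCharSum (n d : ℕ) :
    (numColourSymm n d : ℂ) = 1 / ((d.factorial : ℂ) * (n.factorial : ℂ) ^ 2) *
      ∑ α : Perm (Fin d), permCharSum n α := by
  have h := congrArg (Nat.cast (R := ℂ)) (numColourSymm_mul_eq_sum_fixCount n d)
  push_cast at h
  simp only [permCharSum_eq_sum_fixCount]
  rw [← h]
  have h1 := factorial_ne_zero_complex d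
  have h2 := factorial_ne_zero_complex n
  field_simp

theorem numColourSymm_eq_sum_partitionCharSum (n d : ℕ) :
    (numColourSymm n d : ℂ) = 1 / (n.factorial : ℂ) ^ 2 *
      ∑ p : d.Partition, 1 / (symFactor p : ℂ) * partitionCharSum n p := by
  rw [numColourSymm_eq_sum_permCharSum]
  simp only [permCharSum_eq_partitionCharSum]
  rw [sum_perm_eq_sum_partition]
  have h1 := factorial_ne_zero_complex d
  have h2 := factorial_ne_zero_complex n
  field_simp

/-! ### The character of `S_d` on `𝒦(n,d)` -/

theorem trace_eq_card_fixed {G : Type*} [Fintype G] [DecidableEq G]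
    (f : MonoidAlgebra ℂ G →ₗ[ℂ] MonoidAlgebra ℂ G) (π : G → G)
    (hf : ∀ s, f (MonoidAlgebra.single s 1) = MonoidAlgebra.single (π s) 1) :
    LinearMap.trace ℂ _ f = (Finset.univ.filter fun s => π s = s).card := by
  rw [LinearMap.trace_eq_matrix_trace ℂ (MonoidAlgebra.basis G ℂ), Matrix.trace,
    Finset.card_filter, Nat.cast_sum]
  refine Finset.sum_congr rfl fun s _ => ?_
  rw [Matrix.diag_apply, LinearMap.toMatrix_apply]
  have h1 : MonoidAlgebra.basis G ℂ s = MonoidAlgebra.single s 1 := by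
    simp
  rw [h1, hf]
  have h2 : (MonoidAlgebra.basis G ℂ).repr (MonoidAlgebra.single (π s) 1) =
      Finsupp.single (π s) 1 := by
    have := (MonoidAlgebra.basis G ℂ).repr_self (π s)
    simpa using this
  rw [h2, Finsupp.single_apply]
  split_ifs <;> simp

/-- The averaging projection of `ℂ(S_n)^{⊗ d}` onto `𝒦(n,d)`. -/
noncomputable def averageProj (n d : ℕ) : TensorAlg n d →ₗ[ℂ] TensorAlg n d :=
  ((n.factorial : ℂ) ^ 2)⁻¹ • ∑ γ₁ : Perm (Fin n), ∑ γ₂ : Perm (Fin n),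
    LinearMap.mulLeft ℂ (diagElem n d γ₁) ∘ₗ LinearMap.mulRight ℂ (diagElem n d γ₂)

theorem averageProj_apply (n d : ℕ) (x : TensorAlg n d) :
    averageProj n d x = ((n.factorial : ℂ) ^ 2)⁻¹ • ∑ γ₁ : Perm (Fin n), ∑ γ₂ : Perm (Fin n),
      diagElem n d γ₁ * x * diagElem n d γ₂ := by
  simp [averageProj, mul_assoc]

theorem diagElem_mul (n d : ℕ) (γ δ : Perm (Fin n)) :
    diagElem n d (γ * δ) = diagElem n d γ * diagElem n d δ :=
  map_mul (MonoidAlgebra.of ℂ (Fin d → Perm (Fin n))) (fun _ => γ) (fun _ => δ)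

theorem averageProj_mem (n d : ℕ) (x : TensorAlg n d) :
    averageProj n d x ∈ (KSub n d).toSubmodule := by
  intro δ₁ δ₂
  rw [averageProj_apply, mul_smul_comm, smul_mul_assoc, Finset.mul_sum, Finset.sum_mul]
  congr 1
  refine Fintype.sum_equiv (Equiv.mulLeft δ₁) _ _ fun γ₁ => ?_
  rw [Finset.mul_sum, Finset.sum_mul]
  refine Fintype.sum_equiv (Equiv.mulRight δ₂) _ _ fun γ₂ => ?_
  simp only [Equiv.coe_mulLeft, Equiv.coe_mulRight, diagElem_mul, mul_assoc]

theorem averageProj_eq_self (n d : ℕ) {x : TensorAlg n d} (hx : x ∈ (KSub n d).toSubmodule) :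
    averageProj n d x = x := by
  have h : ∀ γ₁ γ₂, diagElem n d γ₁ * x * diagElem n d γ₂ = x := hx
  rw [averageProj_apply]
  simp only [h, Finset.sum_const, Finset.card_univ, Fintype.card_perm, Fintype.card_fin]
  rw [← Nat.cast_smul_eq_nsmul ℂ, ← Nat.cast_smul_eq_nsmul ℂ, smul_smul, smul_smul]
  have := factorial_ne_zero_complex n
  rw [show ((n.factorial : ℂ) ^ 2)⁻¹ * (n.factorial : ℂ) * (n.factorial : ℂ) = 1 by field_simp,
    one_smul]

/-- The composite of `α` with the averaging projection has image in `𝒦(n,d)` and restricts to `α`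
there, so its trace can be taken on the whole group algebra. There it is an average of maps
permuting the basis of tuples, and each trace counts fixed tuples. -/
theorem KRep_character (n : ℕ) {d : ℕ} (α : Perm (Fin d)) :
    (KRep n d).character α = ((n.factorial : ℂ) ^ 2)⁻¹ * permCharSum n α⁻¹ := by
  classical
  have hmem : ∀ x, (colourRep n d α ∘ₗ averageProj n d) x ∈ (KSub n d).toSubmodule := fun x =>
    (KSub n d).apply_mem_toSubmodule α (averageProj_mem n d x)
  have h1 := LinearMap.trace_restrict_eq_of_forall_mem (KSub n d).toSubmodule
    (colourRep n d α ∘ₗ averageProj n d) hmem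
  have h2 : (colourRep n d α ∘ₗ averageProj n d).restrict (fun x _ => hmem x) = KRep n d α := by
    refine LinearMap.ext fun x => Subtype.ext ?_
    show colourRep n d α (averageProj n d x) = colourRep n d α x
    rw [averageProj_eq_self n d x.2]
  rw [h2] at h1
  have h3 : colourRep n d α ∘ₗ averageProj n d = ((n.factorial : ℂ) ^ 2)⁻¹ •
      ∑ γ₁ : Perm (Fin n), ∑ γ₂ : Perm (Fin n), colourRep n d α ∘ₗ
        LinearMap.mulLeft ℂ (diagElem n d γ₁) ∘ₗ LinearMap.mulRight ℂ (diagElem n d γ₂) := by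
    apply LinearMap.ext
    intro x
    simp [averageProj]
  rw [Representation.character, h1, h3, map_smul, map_sum, smul_eq_mul,
    permCharSum_eq_sum_fixCount]
  congr 1
  refine Finset.sum_congr rfl fun γ₁ _ => ?_
  rw [map_sum]
  refine Finset.sum_congr rfl fun γ₂ _ => ?_
  rw [trace_eq_card_fixed _ (fun s a => γ₁ * s (α⁻¹ a) * γ₂), fixCount]
  · congr 2
    ext s
    simp only [Finset.mem_filter, Finset.mem_univ, true_and, funext_iff, eq_comm]
  · intro s
    have h4 := colourRep_of n d α ((fun _ => γ₁) * s * (fun _ => γ₂))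
    rw [map_mul (MonoidAlgebra.of ℂ _), map_mul (MonoidAlgebra.of ℂ _)] at h4
    rw [LinearMap.comp_apply, LinearMap.comp_apply, LinearMap.mulLeft_apply,
      LinearMap.mulRight_apply, ← mul_assoc]
    exact h4

theorem permType_inv {d : ℕ} (α : Perm (Fin d)) : permType α⁻¹ = permType α :=
  (permType_eq_permType_iff _ _).2 (isConj_inv α)

theorem KRep_character_eq_partitionCharSum (n : ℕ) {d : ℕ} (α : Perm (Fin d)) :
    (KRep n d).character α = ((n.factorial : ℂ) ^ 2)⁻¹ * partitionCharSum n (permType α) := by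
  rw [KRep_character, permCharSum_eq_partitionCharSum, permType_inv]

theorem finrank_invariants_KRep (n d : ℕ) :
    Module.finrank ℂ (KRep n d).invariants = numColourSymm n d := by
  have h := (KRep n d).card_inv_mul_sum_char_eq_finrank
  simp only [KRep_character_eq_partitionCharSum, natCard_perm] at h
  rw [← Finset.mul_sum, sum_perm_eq_sum_partition (partitionCharSum n)] at h
  apply Nat.cast_injective (R := ℂ)
  rw [← h, numColourSymm_eq_sum_partitionCharSum]
  have h1 := factorial_ne_zero_complex d
  have h2 := factorial_ne_zero_complex n
  field_simp

/-! ### The character projection onto an isotypic subspace -/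

section Isotypic

variable {G V W U : Type} [Group G] [Fintype G] [AddCommGroup V] [Module ℂ V]
  [AddCommGroup W] [Module ℂ W] [AddCommGroup U] [Module ℂ U]

/-- The projection onto the `σ`-isotypic subspace of `ρ`, given by the character of `σ`. -/
noncomputable def isotypicProj (σ : Representation ℂ G V) (ρ : Representation ℂ G W) : W →ₗ[ℂ] W :=
  ((Nat.card G : ℂ)⁻¹ * Module.finrank ℂ V) • ∑ g : G, σ.character g⁻¹ • ρ g

theorem isotypicProj_comm (σ : Representation ℂ G V) (ρ : Representation ℂ G W) (h : G) :
    isotypicProj σ ρ ∘ₗ ρ h = ρ h ∘ₗ isotypicProj σ ρ := by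
  simp only [isotypicProj, ← Module.End.mul_eq_comp,
    Finset.sum_mul, Finset.mul_sum, smul_mul_assoc, mul_smul_comm]
  congr 1
  refine Fintype.sum_equiv (MulAut.conj h⁻¹).toEquiv _ _ fun g => ?_
  have h1 : (MulAut.conj h⁻¹).toEquiv g = h⁻¹ * g * h := by simp
  have h2 : (h⁻¹ * g * h)⁻¹ = h⁻¹ * g⁻¹ * h⁻¹⁻¹ := by group
  rw [h1, h2, Representation.char_conj, ← map_mul, ← map_mul]
  congr 2
  group

theorem intertwining_isotypicProj (σ : Representation ℂ G V) {τ : Representation ℂ G U}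
    {ρ : Representation ℂ G W} (f : Representation.IntertwiningMap τ ρ) (v : U) :
    isotypicProj σ ρ (f v) = f (isotypicProj σ τ v) := by
  simp [isotypicProj, map_sum, f.isIntertwining]

open scoped Classical in
-- The operator commutes with `G`, so by Schur's lemma it is a scalar, and orthonormality of
-- characters gives its trace.
theorem isotypicProj_irreducible [FiniteDimensional ℂ V] [FiniteDimensional ℂ U]
    (σ : Representation ℂ G V) (τ : Representation ℂ G U) [σ.IsIrreducible] [τ.IsIrreducible] :
    isotypicProj σ τ = if Nonempty (Representation.Equiv σ τ) then LinearMap.id else 0 := by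
  have : Invertible (Nat.card G : ℂ) := invertibleOfNonzero (Nat.cast_ne_zero.2 Nat.card_pos.ne')
  let P : Representation.IntertwiningMap τ τ := ⟨isotypicProj σ τ, isotypicProj_comm σ τ⟩
  obtain ⟨c, hc⟩ :=
    (Representation.IsIrreducible.algebraMap_intertwiningMap_bijective_of_isAlgClosed (ρ := τ) (k := ℂ)).2 P
  have hP : isotypicProj σ τ = c • LinearMap.id := by
    have h1 : P.toLinearMap = c • LinearMap.id := by
      rw [← hc]
      rfl
    exact h1
  have htr : LinearMap.trace ℂ U (isotypicProj σ τ) =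
      Module.finrank ℂ V * (if Nonempty (Representation.Equiv σ τ) then 1 else 0) := by
    rw [← Representation.char_orthonormal τ σ, isotypicProj, map_smul, map_sum, smul_eq_mul,
      mul_comm (Nat.card G : ℂ)⁻¹, mul_assoc]
    congr 2
    refine Finset.sum_congr rfl fun g _ => ?_
    rw [map_smul, smul_eq_mul, mul_comm]
    rfl
  rw [hP, map_smul, LinearMap.trace_id, smul_eq_mul] at htr
  -- The scalar is read off from the trace, so the dimension of `U` must be nonzero.
  have hnt : Nontrivial U := by
    by_contra hU
    rw [not_nontrivial_iff_subsingleton] at hU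
    obtain ⟨a, b, hab⟩ := exists_pair_ne (Subrepresentation τ)
    exact hab (Subrepresentation.toSubmodule_injective (Subsingleton.elim _ _))
  have hdim : (Module.finrank ℂ U : ℂ) ≠ 0 := Nat.cast_ne_zero.2 Module.finrank_pos.ne'
  split_ifs at htr ⊢ with hφ
  · obtain ⟨φ⟩ := hφ
    rw [φ.toLinearEquiv.finrank_eq, mul_one] at htr
    rw [hP, mul_right_cancel₀ hdim (htr.trans (one_mul _).symm), one_smul]
  · rw [mul_zero] at htr
    rw [hP, (mul_eq_zero.1 htr).resolve_right hdim, zero_smul]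

theorem isotypicProj_self [FiniteDimensional ℂ V] (σ : Representation ℂ G V) [σ.IsIrreducible] :
    isotypicProj σ σ = LinearMap.id := by
  classical
  rw [isotypicProj_irreducible, if_pos ⟨Representation.Equiv.refl σ⟩]

omit [Fintype G] in
-- Intertwiners from a trivial action land in the invariants, and an invariant `w` is reached by `v
-- ↦ ℓ v • w`. Beyond triviality, only a functional equal to `1` somewhere is needed.
theorem isotypic_eq_invariants_of_trivial (σ : Representation ℂ G V) (ρ : Representation ℂ G W)
    (hσ : ∀ g v, σ g v = v) (ℓ : V →ₗ[ℂ] ℂ) (v₀ : V) (hℓ : ℓ v₀ = 1) :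
    isotypic σ ρ = ρ.invariants := by
  apply le_antisymm
  · refine iSup_le fun f => ?_
    rintro _ ⟨v, rfl⟩
    intro g
    show ρ g (f v) = f v
    rw [← f.isIntertwining, hσ]
  · intro w hw
    let f : Representation.IntertwiningMap σ ρ :=
      { toLinearMap := ℓ.smulRight w
        isIntertwining' := fun g => by
          refine LinearMap.ext fun v => ?_
          rw [LinearMap.comp_apply, LinearMap.comp_apply, hσ, LinearMap.smulRight_apply, map_smul,
            hw g] }
    refine Submodule.mem_iSup_of_mem f ⟨v₀, ?_⟩
    show ℓ v₀ • w = w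
    rw [hℓ, one_smul]

theorem isotypicProj_intertwining_mem [FiniteDimensional ℂ V] [FiniteDimensional ℂ U]
    (σ : Representation ℂ G V) {τ : Representation ℂ G U} {ρ : Representation ℂ G W}
    [σ.IsIrreducible] [τ.IsIrreducible] (f : Representation.IntertwiningMap τ ρ) (v : U) :
    isotypicProj σ ρ (f v) ∈ isotypic σ ρ := by
  classical
  rw [intertwining_isotypicProj, isotypicProj_irreducible]
  split_ifs with h
  · obtain ⟨φ⟩ := h
    refine Submodule.mem_iSup_of_mem (f.comp φ.toIntertwiningMap) ⟨φ.symm v, ?_⟩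
    show f (φ (φ.symm v)) = f v
    simp
  · rw [LinearMap.zero_apply, map_zero]
    exact Submodule.zero_mem _

omit [Fintype G] in
theorem isIrreducible_ofModule' (M : Type) [AddCommGroup M] [Module ℂ M]
    [Module (MonoidAlgebra ℂ G) M] [IsScalarTower ℂ (MonoidAlgebra ℂ G) M]
    [IsSimpleModule (MonoidAlgebra ℂ G) M] :
    (Representation.ofModule' (k := ℂ) (G := G) M).IsIrreducible := by
  rw [Representation.irreducible_iff_isSimpleModule_asModule]
  let e : (Representation.ofModule' (k := ℂ) (G := G) M).asModule ≃ₗ[MonoidAlgebra ℂ G] M :=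
    { (Representation.ofModule' (k := ℂ) (G := G) M).asModuleEquiv with
      map_smul' := fun r x => by
        show Representation.asAlgebraHom (Representation.ofModule' M) r _ = _
        rw [Representation.asAlgebraHom, Representation.ofModule', Equiv.apply_symm_apply]
        rfl }
  exact IsSimpleModule.congr e

/-- By Maschke's theorem `W` is a sum of simple submodules; on each the projection is the identity
or zero, according to whether it is a copy of `σ`. -/
theorem isotypicProj_mem [FiniteDimensional ℂ V] [FiniteDimensional ℂ W]
    (σ : Representation ℂ G V) (ρ : Representation ℂ G W) [σ.IsIrreducible] (w : W) :
    isotypicProj σ ρ w ∈ isotypic σ ρ := by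
  have : NeZero (Nat.card G : ℂ) := ⟨Nat.cast_ne_zero.2 Nat.card_pos.ne'⟩
  have htop := IsSemisimpleModule.sSup_simples_eq_top (MonoidAlgebra ℂ G) ρ.asModule
  have hw : ρ.asModuleEquiv.symm w ∈
      sSup {m : Submodule (MonoidAlgebra ℂ G) ρ.asModule | IsSimpleModule (MonoidAlgebra ℂ G) m} := by
    rw [htop]
    exact Submodule.mem_top
  suffices h : ∀ x ∈ sSup {m : Submodule (MonoidAlgebra ℂ G) ρ.asModule |
      IsSimpleModule (MonoidAlgebra ℂ G) m},
      isotypicProj σ ρ (ρ.asModuleEquiv x) ∈ isotypic σ ρ from h _ hw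
  intro x hx
  rw [sSup_eq_iSup'] at hx
  induction hx using Submodule.iSup_induction' with
  | mem N v hv =>
    have : IsSimpleModule (MonoidAlgebra ℂ G) N.1 := N.2
    have := isIrreducible_ofModule' (G := G) N.1
    have : FiniteDimensional ℂ N.1 :=
      Module.Finite.of_injective (N.1.subtype.restrictScalars ℂ) N.1.injective_subtype
    let f : Representation.IntertwiningMap (Representation.ofModule' (k := ℂ) (G := G) N.1) ρ :=
      { toLinearMap := ρ.asModuleEquiv.toLinearMap ∘ₗ N.1.subtype.restrictScalars ℂ
        isIntertwining' := fun g => by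
          refine LinearMap.ext fun v => ?_
          have h1 : (Representation.ofModule' (k := ℂ) (G := G) N.1 g v : N.1) =
              MonoidAlgebra.of ℂ G g • v := rfl
          show ρ.asModuleEquiv (Representation.ofModule' (k := ℂ) (G := G) N.1 g v : N.1) =
            ρ g (ρ.asModuleEquiv v)
          rw [h1, Submodule.coe_smul, ρ.asModuleEquiv_map_smul, Representation.asAlgebraHom_of] }
    exact isotypicProj_intertwining_mem σ f ⟨v, hv⟩
  | zero =>
    rw [map_zero, map_zero]
    exact Submodule.zero_mem _
  | add x y _ _ hx hy =>
    rw [map_add, map_add]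
    exact Submodule.add_mem _ hx hy

theorem isProj_isotypicProj [FiniteDimensional ℂ V] [FiniteDimensional ℂ W]
    (σ : Representation ℂ G V) (ρ : Representation ℂ G W) [σ.IsIrreducible] :
    LinearMap.IsProj (isotypic σ ρ) (isotypicProj σ ρ) where
  map_mem := isotypicProj_mem σ ρ
  map_id w hw := by
    induction hw using Submodule.iSup_induction' with
    | mem f w hw =>
      obtain ⟨v, rfl⟩ := hw
      have h := intertwining_isotypicProj σ f v
      rwa [isotypicProj_self] at h
    | zero => exact map_zero _
    | add x y _ _ hx hy => rw [map_add, hx, hy]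

theorem finrank_isotypic [FiniteDimensional ℂ V] [FiniteDimensional ℂ W]
    (σ : Representation ℂ G V) (ρ : Representation ℂ G W) [σ.IsIrreducible] :
    (Module.finrank ℂ (isotypic σ ρ) : ℂ) = (Nat.card G : ℂ)⁻¹ * Module.finrank ℂ V *
      ∑ g : G, σ.character g⁻¹ * ρ.character g := by
  rw [← (isProj_isotypicProj σ ρ).trace, isotypicProj, map_smul, map_sum, smul_eq_mul]
  congr 1
  refine Finset.sum_congr rfl fun g _ => ?_
  rw [map_smul, smul_eq_mul]
  rfl

end Isotypic

/-! ### Isotypic parts of `𝒦(n,d)` and the one-row partition -/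

theorem finrank_KIsotypic (n : ℕ) {d : ℕ} (Y : d.Partition) (s : d.Partition → Perm (Fin d))
    (hs : ∀ p, (s p).partition.parts = p.parts) :
    (Module.finrank ℂ (KIsotypic n d Y) : ℂ) = (irrepDim Y : ℂ) / (n.factorial : ℂ) ^ 2 *
      ∑ p : d.Partition, chi Y (s p) * (1 / (symFactor p : ℂ) * partitionCharSum n p) := by
  have hs' : ∀ p, permType (s p) = p := fun p => Nat.Partition.ext (hs p)
  have hchi : ∀ α, chi Y (s (permType α)) = chi Y α := fun α =>
    chi_eq_of_isConj Y ((permType_eq_permType_iff _ _).1 (hs' _))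
  have h1 : ∀ α : Perm (Fin d), (irrep Y).character α⁻¹ * (KRep n d).character α =
      ((n.factorial : ℂ) ^ 2)⁻¹ * (chi Y (s (permType α)) * partitionCharSum n (permType α)) := by
    intro α
    have h2 : (irrep Y).character α⁻¹ = chi Y (s (permType α)) := (chi_inv Y α).trans (hchi α).symm
    rw [h2, KRep_character_eq_partitionCharSum]
    ring
  rw [KIsotypic, finrank_isotypic]
  simp only [h1]
  rw [← Finset.mul_sum,
    sum_perm_eq_sum_partition (fun p => chi Y (s p) * partitionCharSum n p), natCard_perm,
    irrepDim]
  have h3 : ∑ p : d.Partition, chi Y (s p) * (1 / (symFactor p : ℂ) * partitionCharSum n p) =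
      ∑ p : d.Partition, 1 / (symFactor p : ℂ) * (chi Y (s p) * partitionCharSum n p) :=
    Finset.sum_congr rfl fun p _ => by ring
  rw [h3]
  have h4 := factorial_ne_zero_complex d
  have h5 := factorial_ne_zero_complex n
  field_simp

theorem rowOf_indiscrete {d : ℕ} (k k' : Fin d) :
    rowOf (Nat.Partition.indiscrete d) k = rowOf (Nat.Partition.indiscrete d) k' := by
  -- For `d = 0` the indiscrete partition has no part, hence no row.
  have hd : d ≠ 0 := by
    rintro rfl
    exact k.elim0
  have h1 : (rowLengths (Nat.Partition.indiscrete d)).length = 1 := by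
    show ((Nat.Partition.indiscrete d).parts.sort (· ≥ ·)).length = 1
    rw [Multiset.length_sort, Nat.Partition.indiscrete_parts hd, Multiset.card_singleton]
  have h2 := ((rowLengths (Nat.Partition.indiscrete d)).index k).isLt
  have h3 := ((rowLengths (Nat.Partition.indiscrete d)).index k').isLt
  unfold rowOf
  omega

/-- With a single row every permutation preserves rows, and only the identity preserves columns. -/
theorem youngSymmetrizer_indiscrete (d : ℕ) :
    youngSymmetrizer (Nat.Partition.indiscrete d) = ∑ g : Perm (Fin d), MonoidAlgebra.of ℂ _ g := by
  have h1 : rowSum (Nat.Partition.indiscrete d) = ∑ g : Perm (Fin d), MonoidAlgebra.of ℂ _ g := by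
    rw [rowSum, Finset.filter_true_of_mem fun g _ k => rowOf_indiscrete _ _]
  have h2 : colSum (Nat.Partition.indiscrete d) = 1 := by
    rw [colSum, Finset.sum_eq_single 1]
    · rw [map_one, map_one]
      simp
    · intro g hg hne
      refine (hne ?_).elim
      ext k
      exact congrArg _ ((leftJustified_rowOf_colOf _).inj _ _ (rowOf_indiscrete _ _)
        ((Finset.mem_filter.1 hg).2 k))
    · simp
  rw [youngSymmetrizer_eq, h1, h2, mul_one]

theorem irrep_indiscrete_apply {d : ℕ} (g : Perm (Fin d))
    (v : IrrepSpace (Nat.Partition.indiscrete d)) : irrep (Nat.Partition.indiscrete d) g v = v := by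
  have hg : ∀ g : Perm (Fin d), MonoidAlgebra.of ℂ _ g *
      youngSymmetrizer (Nat.Partition.indiscrete d) =
      youngSymmetrizer (Nat.Partition.indiscrete d) := by
    intro g
    rw [youngSymmetrizer_indiscrete, Finset.mul_sum]
    refine Fintype.sum_equiv (Equiv.mulLeft g) _ _ fun h => ?_
    rw [← map_mul, Equiv.coe_mulLeft]
  have hx : ∀ x : GroupAlg d, ∃ z : ℂ, x * youngSymmetrizer (Nat.Partition.indiscrete d) =
      z • youngSymmetrizer (Nat.Partition.indiscrete d) := by
    intro x
    induction x using MonoidAlgebra.induction_on with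
    | of g => exact ⟨1, by rw [hg, one_smul]⟩
    | add x y hx hy =>
      obtain ⟨z, hz⟩ := hx
      obtain ⟨w, hw⟩ := hy
      exact ⟨z + w, by rw [add_mul, hz, hw, add_smul]⟩
    | smul r x hx =>
      obtain ⟨z, hz⟩ := hx
      exact ⟨r * z, by rw [smul_mul_assoc, hz, smul_smul]⟩
  obtain ⟨x, hxv⟩ := Ideal.mem_span_singleton'.1 v.2
  obtain ⟨z, hz⟩ := hx x
  apply Subtype.ext
  rw [irrep_apply_coe, ← hxv, hz, mul_smul_comm, hg]

theorem isotypic_indiscrete {d : ℕ} {W : Type} [AddCommGroup W] [Module ℂ W]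
    (ρ : Representation ℂ (Perm (Fin d)) W) :
    isotypic (irrep (Nat.Partition.indiscrete d)) ρ = ρ.invariants := by
  -- The coefficient of the identity, which is `1` on the Young symmetrizer.
  let ℓ : IrrepSpace (Nat.Partition.indiscrete d) →ₗ[ℂ] ℂ :=
    { toFun := fun v => (v : GroupAlg d).coeff 1
      map_add' := fun _ _ => rfl
      map_smul' := fun _ _ => rfl }
  exact isotypic_eq_invariants_of_trivial _ ρ irrep_indiscrete_apply ℓ
    ⟨_, Ideal.mem_span_singleton_self (youngSymmetrizer _)⟩ (youngSymmetrizer_coeff_one _)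

end TensorInvariants

theorem mainTheorem11 (n d : ℕ) :
    -- the number of colour-symmetrised invariants, as a sum over `S_d` and over partitions of `d`
    (TensorInvariants.numColourSymm n d : ℂ) =
        1 / ((d.factorial : ℂ) * (n.factorial : ℂ) ^ 2) *
          ∑ α : Equiv.Perm (Fin d), TensorInvariants.permCharSum n α ∧
    (TensorInvariants.numColourSymm n d : ℂ) =
        1 / (n.factorial : ℂ) ^ 2 *
          ∑ p : d.Partition, 1 / (TensorInvariants.symFactor p : ℂ) *
            TensorInvariants.partitionCharSum n p ∧
    -- it is the dimension of the `S_d`-invariant part of `𝒦(n,d)`, which is the part with `Y = [d]`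
    Module.finrank ℂ (TensorInvariants.KRep n d).invariants =
        TensorInvariants.numColourSymm n d ∧
    TensorInvariants.KIsotypic n d (Nat.Partition.indiscrete d) =
        (TensorInvariants.KRep n d).invariants ∧
    -- the dimension of `𝒦(n,d)_Y`; here `s p` is any permutation of cycle type `p`
    ∀ (Y : d.Partition) (s : d.Partition → Equiv.Perm (Fin d)),
      (∀ p, (s p).partition.parts = p.parts) →
      (Module.finrank ℂ (TensorInvariants.KIsotypic n d Y) : ℂ) =
        (TensorInvariants.irrepDim Y : ℂ) / (n.factorial : ℂ) ^ 2 *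
          ∑ p : d.Partition, TensorInvariants.chi Y (s p) *
            (1 / (TensorInvariants.symFactor p : ℂ) *
              TensorInvariants.partitionCharSum n p) :=
  ⟨TensorInvariants.numColourSymm_eq_sum_permCharSum n d,
    TensorInvariants.numColourSymm_eq_sum_partitionCharSum n d,
    TensorInvariants.finrank_invariants_KRep n d,
    TensorInvariants.isotypic_indiscrete (TensorInvariants.KRep n d),
    TensorInvariants.finrank_KIsotypic n⟩
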